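/- Let $\Gamma$ be a countable discrete group and let $(Z,\Gamma)$ be a topologically free $\Gamma$-boundary, i.e. an action by homeomorphisms on a nonempty compact Hausdorff space $Z$ such that every orbit is dense (minimality), for every regular Borel probability measure $\nu$ on $Z$ some point mass lies in the weak-$*$ closure of $\{\gamma_*\nu:\gamma\in\Gamma\}$ (strong proximality), and for every $\gamma\ne e$ the set $\{z:\gamma z=z\}$ has empty interior (topological freeness). A net $(s_i)$ in $\Gamma$ (for instance a sequence) is *strongly proximal on $Z$* if there is a point $z_0\in Z$ with $(s_i)_*\nu\to\delta_{z_0}$ weak-$*$ for every regular Borel probability measure $\nu$ on $Z$. 1. Let $\Gamma$ act by homeomorphisms on a compact Hausdorff space $X$, and suppose that $(X,\Gamma)$ is uniformly rigid, i.e. it has a *rigid net*: a net of (eventually) nontrivial elements of $\Gamma$ converging to $\mathrm{Id}_X$ uniformly on $X$. If some net in $\Gamma$ is at the same time rigid on $X$ and strongly proximal on $Z$, then $(X,\Gamma)$ is almost reflecting: every $C^*$-algebra $\mathcal A$ with $C^*_r(\Gamma)\subseteq\mathcal A\subseteq C(X)\rtimes_r\Gamma$ satisfies $\mathbb E(\mathcal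 A)\subseteq\mathcal A$. Here, for any faithful unital representation $\pi$ of $C(X)$ on a Hilbert space $H$, $C(X)\rtimes_r\Gamma$ is the $C^*$-algebra on $\ell^2(\Gamma,H)$ generated by the operators $(\sigma(a)\xi)(t)=\pi(t^{-1}a)\xi(t)$, $a\in C(X)$, and $(\lambda_s\xi)(t)=\xi(s^{-1}t)$, $s\in\Gamma$; $C^*_r(\Gamma)$ is generated by the $\lambda_s$; and $\mathbb E$ is the canonical conditional expectation, $\mathbb E(\sigma(a)\lambda_s)=\sigma(a)$ if $s=e$ and $0$ otherwise. 2. Let $\Gamma$ act on a standard Borel probability space $(X,\mathcal B,\mu)$ by measure preserving transformations, and suppose that the system is rigid, i.e. it has a *rigid net*: a net $(s_i)$ of (eventually) nontrivial elements of $\Gamma$ with $\mu(s_iA\,\triangle\,A)\to0$ for all $A\in\mathcal B$. If some net in $\Gamma$ is at the same time rigid on $(X,\mathcal B,\mu)$ and strongly proximal on $Z$, then the system is reflecting: every von Neumann algebra $\mathcal A$ with $L(\Gamma)\subseteq\mathcal A\subseteq L^\infty(X,\mu)\rtimes\Gamma$ is of the form $\mathcal A=L^\infty(Y,\eta)\rtimes\Gamma$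 for some factor $(X,\mu,\Gamma)\to(Y,\eta,\Gamma)$. Here $L^\infty(X,\mu)\rtimes\Gamma$ is the von Neumann algebra on $\ell^2(\Gamma,L^2(X,\mu))$ generated by the $\lambda_s$ and by the operators $(\sigma(f)\xi)(t)=(t^{-1}f)\,\xi(t)$ with $f\in L^\infty(X,\mu)$; $L(\Gamma)$ is generated by the $\lambda_s$; a factor is a measure preserving action of $\Gamma$ on a standard Borel probability space $(Y,\eta)$ with a measure preserving, almost everywhere equivariant map $X\to Y$; and $L^\infty(Y,\eta)$ is regarded as a subalgebra of $L^\infty(X,\mu)$ through this map. -/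

import Mathlib

open Filter Topology MeasureTheory
open scoped ENNReal Pointwise symmDiff

noncomputable section

/-! ### Boundaries, strongly proximal nets, rigid nets -/

section Dynamics

variable (Γ : Type*) [Group Γ]

/-- The action is topologically free: the fixed point set of every `γ ≠ 1` has empty interior. -/
def IsTopologicallyFree (Z : Type*) [TopologicalSpace Z] [MulAction Γ Z] : Prop :=
  ∀ γ : Γ, γ ≠ 1 → interior (MulAction.fixedBy Z γ) = ∅

variable {Γ}

/-- The push-forwards `(s i)_* ν` converge weak-* to the point mass at `z₀` along `l`. -/
def PushTendstoDirac {Z : Type*} [TopologicalSpace Z] [MeasurableSpace Z] [MulAction Γ Z]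
    {ι : Type*} (l : Filter ι) (s : ι → Γ) (ν : Measure Z) (z₀ : Z) : Prop :=
  ∀ f : C(Z, ℝ), Tendsto (fun i => ∫ z, f z ∂(ν.map fun y : Z => s i • y)) l (𝓝 (f z₀))

variable (Γ) in
/-- A flow is strongly proximal if the orbit of every regular Borel probability measure has a point
mass in its weak-* closure. (A net in `Γ` is encoded by a proper filter on `Γ`.) -/
def IsStronglyProximal (Z : Type*) [TopologicalSpace Z] [MeasurableSpace Z]
    [MulAction Γ Z] : Prop :=
  ∀ ν : Measure Z, IsProbabilityMeasure ν → ν.Regular →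
    ∃ (l : Filter Γ) (z₀ : Z), l.NeBot ∧ PushTendstoDirac l id ν z₀

variable (Γ) in
/-- A `Γ`-boundary: a (nonempty) minimal strongly proximal flow. -/
structure IsBoundary (Z : Type*) [TopologicalSpace Z] [MeasurableSpace Z]
    [MulAction Γ Z] : Prop where
  nonempty : Nonempty Z
  minimal : MulAction.IsMinimal Γ Z
  stronglyProximal : IsStronglyProximal Γ Z

/-- The net `s` (indexed by `ι` and running along the filter `l`; for a sequence `ι = ℕ` and
`l = atTop`) is strongly proximal on `Z`: there is one point `z₀` such that `(s i)_* ν → δ_{z₀}`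
weak-* for every regular Borel probability measure `ν`. -/
def IsStronglyProximalNet (Z : Type*) [TopologicalSpace Z] [MeasurableSpace Z] [MulAction Γ Z]
    {ι : Type*} (l : Filter ι) (s : ι → Γ) : Prop :=
  ∃ z₀ : Z, ∀ ν : Measure Z, IsProbabilityMeasure ν → ν.Regular → PushTendstoDirac l s ν z₀

/-- A rigid net on the flow `X`: nontrivial group elements which, acting on `X`, converge uniformly
to the identity. (On a compact Hausdorff space the uniformity is unique.) -/
structure IsRigidNet (X : Type*) [UniformSpace X] [MulAction Γ X]
    {ι : Type*} (l : Filter ι) (s : ι → Γ) : Prop where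
  ne_one : ∀ᶠ i in l, s i ≠ 1
  tendsto : TendstoUniformly (fun i (x : X) => s i • x) id l

variable (Γ) in
/-- A flow is uniformly rigid if it has a rigid net. -/
def IsUniformlyRigid (X : Type*) [UniformSpace X] [MulAction Γ X] : Prop :=
  ∃ l : Filter Γ, l.NeBot ∧ IsRigidNet X l (id : Γ → Γ)

/-- A rigid net for a probability measure preserving action: nontrivial group elements with
`μ(s_i A ∆ A) → 0` for all measurable `A`. -/
structure IsMeasureRigidNet {X : Type*} [MeasurableSpace X] [MulAction Γ X] (μ : Measure X)
    {ι : Type*} (l : Filter ι) (s : ι → Γ) : Prop where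
  ne_one : ∀ᶠ i in l, s i ≠ 1
  tendsto : ∀ A : Set X, MeasurableSet A → Tendsto (fun i => μ ((s i • A) ∆ A)) l (𝓝 0)

variable (Γ) in
/-- A probability measure preserving action is rigid if it has a rigid net. -/
def IsMeasureRigid {X : Type*} [MeasurableSpace X] [MulAction Γ X] (μ : Measure X) : Prop :=
  ∃ l : Filter Γ, l.NeBot ∧ IsMeasureRigidNet μ l (id : Γ → Γ)

end Dynamics

/-! ### Operators on `ℓ²(Γ, H)` -/

section Operators

variable (Γ : Type*) (H : Type*) [NormedAddCommGroup H]

/-- The Hilbert space `ℓ²(Γ, H)` of square summable `H`-valued functions on `Γ`. -/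
abbrev EllTwo : Type _ := lp (fun _ : Γ => H) 2

variable {Γ H}

theorem memlp_translate [Group Γ] (s : Γ) (ξ : EllTwo Γ H) :
    Memℓp (fun t : Γ => ξ (s⁻¹ * t)) 2 := by
  have h := lp.memℓp ξ
  rw [memℓp_gen_iff (by simp)] at h ⊢
  exact (Equiv.mulLeft s⁻¹).summable_iff.2 h

variable [InnerProductSpace ℂ H]

/-- Left translation `(λ_s ξ)(t) = ξ(s⁻¹ t)` on `ℓ²(Γ, H)`. -/
def leftTranslation [Group Γ] (s : Γ) : EllTwo Γ H →L[ℂ] EllTwo Γ H :=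
  LinearMap.mkContinuous
    { toFun := fun ξ => ⟨fun t : Γ => ξ (s⁻¹ * t), memlp_translate s ξ⟩
      map_add' := fun _ _ => rfl
      map_smul' := fun _ _ => rfl } 1 (by
    intro ξ
    rw [one_mul]
    have h2 : (0 : ℝ) < (2 : ℝ≥0∞).toReal := by simp
    rw [lp.norm_eq_tsum_rpow h2, lp.norm_eq_tsum_rpow h2]
    exact le_of_eq (congrArg (fun x : ℝ => x ^ (1 / (2 : ℝ≥0∞).toReal))
      ((Equiv.mulLeft s⁻¹).tsum_eq (fun t : Γ => ‖ξ t‖ ^ (2 : ℝ≥0∞).toReal))))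

@[simp] theorem leftTranslation_apply [Group Γ] (s : Γ) (ξ : EllTwo Γ H) (t : Γ) :
    leftTranslation s ξ t = ξ (s⁻¹ * t) := rfl

theorem norm_diagonal_apply_le (D : lp (fun _ : Γ => H →L[ℂ] H) ∞) (ξ : EllTwo Γ H) (t : Γ) :
    ‖D t (ξ t)‖ ≤ ‖(‖D‖ : ℂ) • ξ t‖ := by
  rw [norm_smul, Complex.norm_real, Real.norm_of_nonneg (norm_nonneg D)]
  exact (D t).le_of_opNorm_le (lp.norm_apply_le_norm (by simp) D t) _

theorem memlp_diagonal (D : lp (fun _ : Γ => H →L[ℂ] H) ∞) (ξ : EllTwo Γ H) :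
    Memℓp (fun t : Γ => D t (ξ t)) 2 := by
  have h := lp.memℓp ((‖D‖ : ℂ) • ξ)
  rw [memℓp_gen_iff (by simp)] at h ⊢
  refine h.of_nonneg_of_le (fun t => by positivity) fun t => ?_
  exact Real.rpow_le_rpow (norm_nonneg _) (norm_diagonal_apply_le D ξ t) (by simp)

/-- The diagonal operator `(ξ(t))_t ↦ (D(t) ξ(t))_t` of a bounded family `D` of operators. -/
def diagonalOp (D : lp (fun _ : Γ => H →L[ℂ] H) ∞) : EllTwo Γ H →L[ℂ] EllTwo Γ H :=
  LinearMap.mkContinuous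
    { toFun := fun ξ => ⟨fun t : Γ => D t (ξ t), memlp_diagonal D ξ⟩
      map_add' := fun ξ η => lp.ext (funext fun t => map_add (D t) (ξ t) (η t))
      map_smul' := fun c ξ => lp.ext (funext fun t => map_smul (D t) c (ξ t)) } ‖D‖ (by
    intro ξ
    have h := lp.norm_mono (p := 2) (by simp)
      (x := (⟨fun t : Γ => D t (ξ t), memlp_diagonal D ξ⟩ : EllTwo Γ H))
      (y := (‖D‖ : ℂ) • ξ) (fun t => norm_diagonal_apply_le D ξ t)
    rwa [norm_smul, Complex.norm_real, Real.norm_of_nonneg (norm_nonneg D)] at h)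

@[simp] theorem diagonalOp_apply (D : lp (fun _ : Γ => H →L[ℂ] H) ∞) (ξ : EllTwo Γ H) (t : Γ) :
    diagonalOp D ξ t = D t (ξ t) := rfl

theorem norm_diagonalOp_le (D : lp (fun _ : Γ => H →L[ℂ] H) ∞) : ‖diagonalOp D‖ ≤ ‖D‖ := by
  unfold diagonalOp
  exact LinearMap.mkContinuous_norm_le _ (norm_nonneg D) _

open Classical in
/-- The `t`-th diagonal block of an operator on `ℓ²(Γ, H)`. -/
def diagonalBlock (T : EllTwo Γ H →L[ℂ] EllTwo Γ H) (t : Γ) : H →L[ℂ] H :=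
  lp.evalCLM ℂ (fun _ : Γ => H) 2 t ∘L T ∘L lp.singleContinuousLinearMap ℂ (fun _ : Γ => H) 2 t

open Classical in
theorem diagonalBlock_apply (T : EllTwo Γ H →L[ℂ] EllTwo Γ H) (t : Γ) (v : H) :
    diagonalBlock T t v = T (lp.single 2 t v) t := rfl

open Classical in
theorem norm_diagonalBlock_le (T : EllTwo Γ H →L[ℂ] EllTwo Γ H) (t : Γ) :
    ‖diagonalBlock T t‖ ≤ ‖T‖ := by
  refine ContinuousLinearMap.opNorm_le_bound _ (norm_nonneg T) fun v => ?_
  have h1 : ‖diagonalBlock T t v‖ ≤ ‖T (lp.single 2 t v)‖ :=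
    lp.norm_apply_le_norm two_ne_zero (T (lp.single 2 t v)) t
  have h2 : ‖T (lp.single 2 t v)‖ ≤ ‖T‖ * ‖lp.single (E := fun _ : Γ => H) 2 t v‖ :=
    T.le_opNorm _
  have h3 : ‖lp.single (E := fun _ : Γ => H) 2 t v‖ = ‖v‖ :=
    lp.norm_single (E := fun _ : Γ => H) (by norm_num : (0 : ℝ≥0∞) < 2) t v
  rw [h3] at h2
  exact h1.trans h2

theorem memlp_diagonalBlock (T : EllTwo Γ H →L[ℂ] EllTwo Γ H) : Memℓp (diagonalBlock T) ∞ :=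
  memℓp_infty ⟨‖T‖, by rintro _ ⟨t, rfl⟩; exact norm_diagonalBlock_le T t⟩

/-- The diagonal part of an operator `T` on `ℓ²(Γ, H)`: the block diagonal operator with the same
diagonal blocks as `T`. It is linear and contractive in `T`, and restricted to a reduced crossed
product it is the canonical conditional expectation `𝔼` onto (the copy of) the coefficient algebra;
see `diagonalPart_coeffOp_mul`. -/
def diagonalPart (T : EllTwo Γ H →L[ℂ] EllTwo Γ H) : EllTwo Γ H →L[ℂ] EllTwo Γ H :=
  diagonalOp ⟨diagonalBlock T, memlp_diagonalBlock T⟩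

open Classical in
theorem diagonalPart_apply (T : EllTwo Γ H →L[ℂ] EllTwo Γ H) (ξ : EllTwo Γ H) (t : Γ) :
    diagonalPart T ξ t = T (lp.single 2 t (ξ t)) t := rfl

/-- On the elements `D λ_s` with `D` diagonal, the diagonal part is `D` if `s = 1` and `0`
otherwise. -/
theorem diagonalPart_diagonalOp_mul [Group Γ] [DecidableEq Γ]
    (D : lp (fun _ : Γ => H →L[ℂ] H) ∞) (s : Γ) :
    diagonalPart (diagonalOp D * leftTranslation s) = if s = 1 then diagonalOp D else 0 := by
  classical
  ext ξ t
  rw [diagonalPart_apply]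
  split_ifs with h
  · subst h
    simp
  · have : s⁻¹ * t ≠ t := by simpa using h
    simp [this]

theorem norm_diagonalPart_le (T : EllTwo Γ H →L[ℂ] EllTwo Γ H) : ‖diagonalPart T‖ ≤ ‖T‖ := by
  have h : ‖diagonalPart T‖ ≤
      ‖(⟨diagonalBlock T, memlp_diagonalBlock T⟩ : lp (fun _ : Γ => H →L[ℂ] H) ∞)‖ :=
    norm_diagonalOp_le _
  exact h.trans (lp.norm_le_of_forall_le (norm_nonneg T) (norm_diagonalBlock_le T))

theorem diagonalPart_add (S T : EllTwo Γ H →L[ℂ] EllTwo Γ H) :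
    diagonalPart (S + T) = diagonalPart S + diagonalPart T :=
  ContinuousLinearMap.ext fun _ => lp.ext (funext fun _ => rfl)

theorem diagonalPart_smul (c : ℂ) (T : EllTwo Γ H →L[ℂ] EllTwo Γ H) :
    diagonalPart (c • T) = c • diagonalPart T :=
  ContinuousLinearMap.ext fun _ => lp.ext (funext fun _ => rfl)

end Operators

/-! ### The reduced crossed product of a flow -/

section Topological

variable {Γ : Type*} [Group Γ] {H : Type*} [NormedAddCommGroup H] [InnerProductSpace ℂ H]
  [CompleteSpace H]

variable (Γ H) in
/-- The reduced group C⋆-algebra `C⋆_r(Γ)`, as the C⋆-algebra generated by the left translations of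
`ℓ²(Γ, H)`. -/
def reducedGroupCStarAlgebra : StarSubalgebra ℂ (EllTwo Γ H →L[ℂ] EllTwo Γ H) :=
  (StarAlgebra.adjoin ℂ (Set.range fun s : Γ => leftTranslation (H := H) s)).topologicalClosure

variable {X : Type*} [TopologicalSpace X] [CompactSpace X] [MulAction Γ X] [ContinuousConstSMul Γ X]

/-- The function `t⁻¹ · a`, that is `x ↦ a (t x)`. -/
def invTranslate (t : Γ) (a : C(X, ℂ)) : C(X, ℂ) :=
  a.comp ⟨fun x => t • x, continuous_const_smul t⟩

theorem memlp_coeff (π : C(X, ℂ) →⋆ₐ[ℂ] (H →L[ℂ] H)) (a : C(X, ℂ)) :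
    Memℓp (fun t : Γ => π (invTranslate t a)) ∞ := by
  refine memℓp_infty ⟨‖a‖, ?_⟩
  rintro _ ⟨t, rfl⟩
  refine (NonUnitalStarAlgHom.norm_apply_le π _).trans ?_
  exact (ContinuousMap.norm_le _ (norm_nonneg a)).2 fun x => a.norm_coe_le_norm _

variable (Γ) in
/-- The operator `(σ(a) ξ)(t) = π(t⁻¹ · a) ξ(t)` on `ℓ²(Γ, H)`. -/
def coeffOp (π : C(X, ℂ) →⋆ₐ[ℂ] (H →L[ℂ] H)) (a : C(X, ℂ)) : EllTwo Γ H →L[ℂ] EllTwo Γ H :=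
  diagonalOp ⟨fun t : Γ => π (invTranslate t a), memlp_coeff π a⟩

variable (Γ) in
/-- The reduced crossed product `C(X) ⋊_r Γ` on `ℓ²(Γ, H)` attached to a faithful representation
`π` of `C(X)` on `H`: the C⋆-algebra generated by the `σ(a)` and the `λ_s`. -/
def reducedCrossedProduct (π : C(X, ℂ) →⋆ₐ[ℂ] (H →L[ℂ] H)) :
    StarSubalgebra ℂ (EllTwo Γ H →L[ℂ] EllTwo Γ H) :=
  (StarAlgebra.adjoin ℂ (Set.range (coeffOp Γ π) ∪
    Set.range fun s : Γ => leftTranslation (H := H) s)).topologicalClosure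

/-- The canonical conditional expectation satisfies `𝔼(σ(a) λ_s) = σ(a)` if `s = 1`, and `0`
otherwise. -/
theorem diagonalPart_coeffOp_mul [DecidableEq Γ] (π : C(X, ℂ) →⋆ₐ[ℂ] (H →L[ℂ] H)) (a : C(X, ℂ))
    (s : Γ) :
    diagonalPart (coeffOp Γ π a * leftTranslation s) = if s = 1 then coeffOp Γ π a else 0 :=
  diagonalPart_diagonalOp_mul _ s

variable (Γ) in
/-- `C(X) ⋊_r Γ` is almost reflecting: `𝔼(𝒜) ⊆ 𝒜` for every intermediate C⋆-algebra
`C⋆_r(Γ) ⊆ 𝒜 ⊆ C(X) ⋊_r Γ`. -/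
def IsAlmostReflecting (π : C(X, ℂ) →⋆ₐ[ℂ] (H →L[ℂ] H)) : Prop :=
  ∀ A : StarSubalgebra ℂ (EllTwo Γ H →L[ℂ] EllTwo Γ H),
    IsClosed (A : Set (EllTwo Γ H →L[ℂ] EllTwo Γ H)) →
    reducedGroupCStarAlgebra Γ H ≤ A → A ≤ reducedCrossedProduct Γ π →
    ∀ T ∈ A, diagonalPart T ∈ A

end Topological

/-! ### The von Neumann crossed product of a measure preserving system -/

section Measurable

/-- The von Neumann algebra generated by a set of operators: the double commutant of `S ∪ S⋆`. -/
def vonNeumannGenerated {K : Type*} [NormedAddCommGroup K] [InnerProductSpace ℂ K]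
    [CompleteSpace K] (S : Set (K →L[ℂ] K)) : VonNeumannAlgebra K where
  toStarSubalgebra := StarSubalgebra.centralizer ℂ (StarSubalgebra.centralizer ℂ S : Set (K →L[ℂ] K))
  centralizer_centralizer' := by
    change Set.centralizer (Set.centralizer
      (StarSubalgebra.centralizer ℂ (StarSubalgebra.centralizer ℂ S : Set (K →L[ℂ] K)) :
        Set (K →L[ℂ] K))) =
      (StarSubalgebra.centralizer ℂ (StarSubalgebra.centralizer ℂ S : Set (K →L[ℂ] K)) :
        Set (K →L[ℂ] K))
    rw [StarSubalgebra.coe_centralizer_centralizer, Set.centralizer_centralizer_centralizer]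

/-- The multiplication operator `ξ ↦ f ξ` on `L²(X, μ)`, for `f ∈ L^∞(X, μ)`. -/
def mulOp {X : Type*} [MeasurableSpace X] (μ : Measure X) (f : Lp ℂ ∞ μ) :
    Lp ℂ 2 μ →L[ℂ] Lp ℂ 2 μ :=
  (ContinuousLinearMap.mul ℂ ℂ).holderL μ ∞ 2 2 f

/-- The group von Neumann algebra `L(Γ)`, generated by the left translations of
`ℓ²(Γ, L²(X, μ))`. -/
def groupVonNeumannAlgebra (Γ : Type*) [Group Γ] {X : Type*} [MeasurableSpace X] (μ : Measure X) :
    VonNeumannAlgebra (EllTwo Γ (Lp ℂ 2 μ)) :=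
  vonNeumannGenerated (Set.range fun s : Γ => leftTranslation (H := Lp ℂ 2 μ) s)

variable (Γ : Type*) [Group Γ] {X : Type*} [MeasurableSpace X] [MulAction Γ X]
  [MeasurableConstSMul Γ X] (μ : Measure X) [SMulInvariantMeasure Γ X μ]

theorem memlp_vnCoeff (f : Lp ℂ ∞ μ) :
    Memℓp (fun t : Γ => mulOp μ
      (Lp.compMeasurePreserving (fun x : X => t • x) (measurePreserving_smul t μ) f)) ∞ := by
  refine memℓp_infty ⟨‖(ContinuousLinearMap.mul ℂ ℂ).holderL μ ∞ 2 2‖ * ‖f‖, ?_⟩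
  rintro _ ⟨t, rfl⟩
  refine (ContinuousLinearMap.le_opNorm _ _).trans_eq ?_
  rw [Lp.norm_compMeasurePreserving]

/-- The operator `(σ(f) ξ)(t) = (t⁻¹ · f) ξ(t)` on `ℓ²(Γ, L²(X, μ))`, for `f ∈ L^∞(X, μ)`, where
`(t⁻¹ · f)(x) = f (t x)`. -/
def vnCoeffOp (f : Lp ℂ ∞ μ) : EllTwo Γ (Lp ℂ 2 μ) →L[ℂ] EllTwo Γ (Lp ℂ 2 μ) :=
  diagonalOp ⟨_, memlp_vnCoeff Γ μ f⟩

/-- The von Neumann crossed product `L^∞(X, μ) ⋊ Γ`. -/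
def vonNeumannCrossedProduct : VonNeumannAlgebra (EllTwo Γ (Lp ℂ 2 μ)) :=
  vonNeumannGenerated (Set.range (vnCoeffOp Γ μ) ∪
    Set.range fun s : Γ => leftTranslation (H := Lp ℂ 2 μ) s)

/-- A factor `(X, μ, Γ) → (Y, η, Γ)`: a probability measure preserving action of `Γ` on a standard
Borel space `Y` and an almost everywhere equivariant measure preserving map `X → Y`. (Every standard
Borel space is isomorphic to one in `Type`.) -/
structure MeasurableFactor where
  Y : Type
  [measurableSpace : MeasurableSpace Y]
  [standardBorel : StandardBorelSpace Y]
  [mulAction : MulAction Γ Y]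
  [measurableSMul : MeasurableConstSMul Γ Y]
  η : Measure Y
  [invariant : SMulInvariantMeasure Γ Y η]
  toFun : X → Y
  measurePreserving : MeasurePreserving toFun μ η
  equivariant : ∀ γ : Γ, ∀ᵐ x ∂μ, toFun (γ • x) = γ • toFun x

attribute [instance] MeasurableFactor.measurableSpace

/-- The subalgebra `L^∞(Y, η) ⋊ Γ` of `L^∞(X, μ) ⋊ Γ` given by a factor: it is generated by the left
translations and by the `σ(g ∘ π)` for `g ∈ L^∞(Y, η)`, where `π : X → Y` is the factor map. -/
def MeasurableFactor.crossedProduct {Γ : Type*} [Group Γ] {X : Type*} [MeasurableSpace X]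
    [MulAction Γ X] [MeasurableConstSMul Γ X] {μ : Measure X} [SMulInvariantMeasure Γ X μ]
    (F : MeasurableFactor Γ μ) : VonNeumannAlgebra (EllTwo Γ (Lp ℂ 2 μ)) :=
  vonNeumannGenerated
    ((Set.range fun g : Lp ℂ ∞ F.η =>
        vnCoeffOp Γ μ (Lp.compMeasurePreserving F.toFun F.measurePreserving g)) ∪
      Set.range fun s : Γ => leftTranslation (H := Lp ℂ 2 μ) s)

/-- `L^∞(X, μ) ⋊ Γ` is reflecting: every intermediate von Neumann algebra
`L(Γ) ⊆ 𝒜 ⊆ L^∞(X, μ) ⋊ Γ` is of the form `L^∞(Y, η) ⋊ Γ` for a factor `(X, μ, Γ) → (Y, η, Γ)`. -/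
def IsReflecting : Prop :=
  ∀ A : VonNeumannAlgebra (EllTwo Γ (Lp ℂ 2 μ)),
    groupVonNeumannAlgebra Γ μ ≤ A → A ≤ vonNeumannCrossedProduct Γ μ →
    ∃ F : MeasurableFactor Γ μ, A = F.crossedProduct

end Measurable

end

/-!
Both parts rest on averaging the conjugates `λ_g⁻¹ T λ_g` of an element `T` of the intermediate
algebra over convex combinations of elements `g` far out in the given net. Such averages stay in
the algebra. If `T = ∑ σ(a_γ) λ_γ` is a finite sum, then `λ_g⁻¹ σ(a) λ_γ λ_g` is
`σ(g⁻¹ · a) λ_{g⁻¹ γ g}`. Rigidity makes `g⁻¹ · a` close to `a`, so the coefficient at `γ = 1`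
survives, while the terms with `γ ≠ 1` tend to `0` as soon as the averages of the unitaries
`λ_{g⁻¹ γ g}` do. Hence the averages converge to `𝔼(T)`, which must lie in the algebra.

That the averages of `λ_{g⁻¹ γ g}` become small in norm is where the boundary `Z` enters
(`exists_average_conj_small`). By minimality and topological freeness the net can be conjugated so
that its limit point `z₀` is moved by the finitely many `γ` in question; let `U` be a neighbourhood
of `z₀` disjoint from `γ U`. Then `g⁻¹ γ g` maps the complement of `W_g = g⁻¹ (Z ∖ U)` into
`W_g`. Strong proximality says that `ν(W_g) → 0` for every regular probability measure `ν`, so by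
the theorems of Hahn–Banach and Riesz–Markov–Kakutani suitable convex combinations of the functions
`1_{W_g}` are uniformly small (`exists_convexCombination_lt_of_tendsto_integral`). The sets `W_g`
therefore hardly overlap, and the estimate used for Powers groups
(`norm_sum_smul_leftTranslation_le`) bounds the norm of the average of the `λ_{g⁻¹ γ g}`.

In the topological case finite sums are norm dense, and this is the whole proof
(`isAlmostReflecting_of_rigid_of_proximal`). In the measurable case the averages are bounded, and
their convergence is tested on the canonical vector `δ_1 ⊗ 1`, which is cyclic for the commutant
(`tendsto_apply_of_tendsto_canonicalVector`); the limit is strong, hence `𝔼(𝒜) ⊆ 𝒜`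
(`diagonalPart_mem_of_rigid_of_proximal`). The algebra `𝒜` is then recovered from its Fourier
coefficients. They are the bounded functions measurable with respect to an invariant `σ`-algebra,
which a countable `L²`-dense set of coefficients realizes as a factor
(`exists_factor_forall_isCoeff_iff`); and an element of the crossed product with coefficients in
`L^∞(Y)` commutes with the commutant of `L^∞(Y) ⋊ Γ`, by comparing matrix entries
(`mem_of_forall_coeff_mem`).
-/

open Filter Topology MeasureTheory
open scoped ENNReal Pointwise symmDiff

/-! ### Uniformly small convex combinations -/

/-- A net of nonnegative continuous functions whose integrals against every regular probability
measure tend to `0` has convex combinations that are uniformly small. This is Mazur's theorem for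
`C(Z, ℝ)`; positivity of the functions means that separating functionals may be taken positive, so
that only measures (and no signed measures) are needed. -/
theorem exists_convexCombination_lt_of_tendsto_integral
    {Z : Type*} [TopologicalSpace Z] [CompactSpace Z] [T2Space Z]
    [MeasurableSpace Z] [BorelSpace Z] {ι : Type*} {l : Filter ι} [l.NeBot] (f : ι → C(Z, ℝ))
    (hf : ∀ ν : Measure Z, IsProbabilityMeasure ν → ν.Regular →
      Tendsto (fun i => ∫ z, f i z ∂ν) l (𝓝 0))
    {S : Set ι} (hS : S ∈ l) {ε : ℝ} (hε : 0 < ε) :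
    ∃ (κ : Type) (_ : Fintype κ) (w : κ → ℝ) (j : κ → ι), (∀ k, 0 ≤ w k) ∧ ∑ k, w k = 1 ∧
      (∀ k, j k ∈ S) ∧ ∀ z, ∑ k, w k * f (j k) z < ε := by
  by_contra hcon
  let O : Set C(Z, ℝ) := {g | ∀ z, g z < ε}
  have hOconv : Convex ℝ O := by
    intro g hg h hh a b ha hb hab z
    have h1 := hg z
    have h2 := hh z
    simp only [ContinuousMap.add_apply, ContinuousMap.smul_apply, smul_eq_mul]
    rcases ha.eq_or_lt with rfl | ha'
    · have : b = 1 := by linarith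
      subst this
      linarith
    · nlinarith [mul_lt_mul_of_pos_left h1 ha', mul_le_mul_of_nonneg_left h2.le hb]
  have hOopen : IsOpen O := by
    have h : O = {g : C(Z, ℝ) | Set.MapsTo g Set.univ (Set.Iio ε)} := by
      ext g
      simp [O, Set.MapsTo]
    rw [h]
    exact ContinuousMap.isOpen_setOfPred_mapsTo isCompact_univ isOpen_Iio
  have hdisj : Disjoint O (convexHull ℝ (f '' S)) := by
    rw [Set.disjoint_left]
    intro g hgO hgK
    obtain ⟨κ, hκ, w, x, hw, hw1, hx, hsum⟩ := mem_convexHull_iff_exists_fintype.1 hgK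
    choose j hjS hj using hx
    refine hcon ⟨κ, hκ, w, j, hw, hw1, hjS, fun z => ?_⟩
    have := hgO z
    rw [← hsum] at this
    simpa [hj, ContinuousMap.sum_apply] using this
  obtain ⟨φ, u, hφO, hφK⟩ :=
    geometric_hahn_banach_open hOconv hOopen (convex_convexHull ℝ (f '' S)) hdisj
  have hu : 0 < u := by simpa using hφO 0 (fun z => by simpa using hε)
  -- the open set contains `-n g` for all `n` when `g ≥ 0`, so `φ` is positive
  have hpos : ∀ g : C(Z, ℝ), 0 ≤ g → 0 ≤ φ g := by
    intro g hg
    by_contra! hneg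
    obtain ⟨n, hn⟩ := exists_nat_gt (u / (-φ g))
    have h1 : (-(n : ℝ)) • g ∈ O := fun z => by
      have := hg z
      have h2 : 0 ≤ (n : ℝ) * g z := mul_nonneg n.cast_nonneg this
      simp only [ContinuousMap.smul_apply, smul_eq_mul]
      linarith
    have h2 := hφO _ h1
    rw [map_smul, smul_eq_mul] at h2
    rw [div_lt_iff₀ (by linarith)] at hn
    linarith
  let Λ : CompactlySupportedContinuousMap Z ℝ →ₚ[ℝ] ℝ := PositiveLinearMap.mk₀
    { toFun := fun g => φ g.toContinuousMap
      map_add' := fun a b => by rw [← map_add]; rfl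
      map_smul' := fun c a => by
        change φ _ = c • φ _
        rw [← map_smul]; rfl }
    (fun g hg => hpos _ hg)
  let m := RealRMK.rieszMeasure Λ
  have hint : ∀ g : C(Z, ℝ), ∫ z, g z ∂m = φ g := fun g =>
    RealRMK.integral_rieszMeasure Λ (CompactlySupportedContinuousMap.continuousMapEquiv g)
  obtain ⟨i₀, hi₀⟩ := nonempty_of_mem hS
  have hm0 : m ≠ 0 := by
    intro h0
    have h1 := hφK _ (subset_convexHull ℝ _ ⟨i₀, hi₀, rfl⟩)
    rw [← hint, h0, integral_zero_measure] at h1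
    linarith
  have hmuniv : m Set.univ ≠ 0 := by simpa using hm0
  have : NeZero m := ⟨hm0⟩
  let ν : Measure Z := (m Set.univ)⁻¹ • m
  have hνp : IsProbabilityMeasure ν := isProbabilityMeasureSMul
  have hνr : ν.Regular := Measure.Regular.smul (ENNReal.inv_ne_top.2 hmuniv)
  have hlim := hf ν hνp hνr
  have hc : 0 < (m Set.univ)⁻¹.toReal := ENNReal.toReal_pos
    (ENNReal.inv_ne_zero.2 (measure_ne_top m _)) (ENNReal.inv_ne_top.2 hmuniv)
  have hev : ∀ᶠ i in l, (m Set.univ)⁻¹.toReal * u ≤ ∫ z, f i z ∂ν := by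
    filter_upwards [hS] with i hi
    rw [integral_smul_measure, hint, smul_eq_mul]
    exact mul_le_mul_of_nonneg_left (hφK _ (subset_convexHull ℝ _ ⟨i, hi, rfl⟩)) hc.le
  have := ge_of_tendsto hlim hev
  have := mul_pos hc hu
  linarith

/-! ### Averages of translations on `ℓ²(Γ, H)` -/

section Operators

variable {Γ H : Type*} [NormedAddCommGroup H]

open Classical in
/-- The element of `ℓ²(Γ, H)` with value `v` at `t` and `0` elsewhere. -/
noncomputable def pointVector (t : Γ) (v : H) : EllTwo Γ H :=
  lp.single 2 t v

theorem pointVector_apply_self (t : Γ) (v : H) : pointVector t v t = v := by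
  classical
  exact lp.single_apply_self ..

theorem pointVector_apply_of_ne {t r : Γ} (h : r ≠ t) (v : H) : pointVector t v r = 0 := by
  classical
  exact lp.single_apply_ne _ _ _ h

theorem norm_pointVector (t : Γ) (v : H) : ‖pointVector t v‖ = ‖v‖ := by
  classical
  exact lp.norm_single (E := fun _ : Γ => H) (by norm_num) t v

theorem pointVector_sub (t : Γ) (v w : H) :
    pointVector t (v - w) = pointVector t v - pointVector t w := by
  classical
  exact map_sub (lp.singleAddMonoidHom (E := fun _ : Γ => H) 2 t) v w

theorem continuous_pointVector (t : Γ) : Continuous (pointVector t : H → EllTwo Γ H) := by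
  classical
  exact (AddMonoidHomClass.isometry_of_norm
      (lp.singleAddMonoidHom (E := fun _ : Γ => H) 2 t) (norm_pointVector t)).continuous

theorem hasSum_pointVector (ξ : EllTwo Γ H) : HasSum (fun t => pointVector t (ξ t)) ξ := by
  classical
  exact lp.hasSum_single (by simp) ξ

theorem hasSum_norm_sq (ξ : EllTwo Γ H) : HasSum (fun t => ‖ξ t‖ ^ 2) (‖ξ‖ ^ 2) := by
  simpa using lp.hasSum_norm (p := 2) (by simp) ξ

open Classical in
theorem memlp_cutoff (V : Set Γ) (ξ : EllTwo Γ H) :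
    Memℓp (fun t : Γ => if t ∈ V then ξ t else 0) 2 := by
  have h := lp.memℓp ξ
  rw [memℓp_gen_iff (by simp)] at h ⊢
  refine h.of_nonneg_of_le (fun t => by positivity) fun t => ?_
  refine Real.rpow_le_rpow (norm_nonneg _) ?_ (by simp)
  split_ifs <;> simp

/-- The projection of `ℓ²(Γ, H)` onto the functions supported in `V`. -/
noncomputable def cutoff (V : Set Γ) (ξ : EllTwo Γ H) : EllTwo Γ H :=
  ⟨_, memlp_cutoff V ξ⟩

open Classical in
theorem cutoff_apply (V : Set Γ) (ξ : EllTwo Γ H) (t : Γ) :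
    cutoff V ξ t = if t ∈ V then ξ t else 0 := rfl

theorem norm_sub_cutoff_le (V : Set Γ) (ξ : EllTwo Γ H) : ‖ξ - cutoff V ξ‖ ≤ ‖ξ‖ :=
  lp.norm_mono (p := 2) (by simp) fun t => by
    rw [lp.coeFn_sub, Pi.sub_apply, cutoff_apply]
    split_ifs <;> simp

theorem sum_mul_norm_cutoff_le {κ : Type*} [Fintype κ] {w : κ → ℝ} (hw : ∀ k, 0 ≤ w k)
    (hw1 : ∑ k, w k = 1) (V : κ → Set Γ) {δ : ℝ}
    (hδ : ∀ t, ∑ k, w k * (V k).indicator 1 t ≤ δ) (ξ : EllTwo Γ H) :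
    ∑ k, w k * ‖cutoff (V k) ξ‖ ≤ √δ * ‖ξ‖ := by
  classical
  have hsq : ∑ k, w k * ‖cutoff (V k) ξ‖ ^ 2 ≤ δ * ‖ξ‖ ^ 2 := by
    have h1 : HasSum (fun t => ∑ k, w k * ‖cutoff (V k) ξ t‖ ^ 2)
        (∑ k, w k * ‖cutoff (V k) ξ‖ ^ 2) :=
      hasSum_sum fun k _ => (hasSum_norm_sq (cutoff (V k) ξ)).mul_left _
    refine hasSum_le (fun t => ?_) h1 ((hasSum_norm_sq ξ).mul_left δ)
    refine le_trans (le_of_eq ?_) (mul_le_mul_of_nonneg_right (hδ t) (sq_nonneg ‖ξ t‖))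
    rw [Finset.sum_mul]
    refine Finset.sum_congr rfl fun k _ => ?_
    rw [cutoff_apply, Set.indicator_apply]
    split_ifs <;> simp
  have hcs := Finset.sum_mul_sq_le_sq_mul_sq Finset.univ (fun k => √(w k))
    (fun k => √(w k) * ‖cutoff (V k) ξ‖)
  have e1 : ∀ k, √(w k) * (√(w k) * ‖cutoff (V k) ξ‖) = w k * ‖cutoff (V k) ξ‖ := fun k => by
    rw [← mul_assoc, Real.mul_self_sqrt (hw k)]
  simp only [e1, mul_pow, Real.sq_sqrt (hw _), hw1, one_mul] at hcs
  rw [← Real.sqrt_sq (norm_nonneg ξ), ← Real.sqrt_mul' _ (sq_nonneg _)]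
  exact Real.le_sqrt_of_sq_le (hcs.trans hsq)

variable [InnerProductSpace ℂ H]

theorem diagonalPart_pointVector (T : EllTwo Γ H →L[ℂ] EllTwo Γ H) (t : Γ) (v : H) :
    diagonalPart T (pointVector t v) = pointVector t (T (pointVector t v) t) := by
  classical
  refine lp.ext (funext fun r => ?_)
  rw [diagonalPart_apply]
  by_cases h : r = t
  · subst h
    rw [pointVector_apply_self, pointVector_apply_self]
    rfl
  · rw [pointVector_apply_of_ne h, pointVector_apply_of_ne h, lp.single_zero, map_zero]
    rfl

theorem diagonalPart_sub (S T : EllTwo Γ H →L[ℂ] EllTwo Γ H) :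
    diagonalPart (S - T) = diagonalPart S - diagonalPart T :=
  ContinuousLinearMap.ext fun _ => lp.ext (funext fun _ => rfl)

theorem norm_leftTranslation_apply [Group Γ] (s : Γ) (ξ : EllTwo Γ H) :
    ‖leftTranslation s ξ‖ = ‖ξ‖ := by
  have h := (Equiv.mulLeft s⁻¹).hasSum_iff.2 (hasSum_norm_sq ξ)
  have := (hasSum_norm_sq (leftTranslation s ξ)).unique h
  exact (pow_left_inj₀ (norm_nonneg _) (norm_nonneg _) two_ne_zero).1 this

theorem norm_leftTranslation_le [Group Γ] (s : Γ) :
    ‖(leftTranslation s : EllTwo Γ H →L[ℂ] EllTwo Γ H)‖ ≤ 1 :=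
  ContinuousLinearMap.opNorm_le_bound _ zero_le_one fun ξ => by
    rw [norm_leftTranslation_apply, one_mul]

theorem leftTranslation_mul [Group Γ] (s t : Γ) :
    (leftTranslation (s * t) : EllTwo Γ H →L[ℂ] EllTwo Γ H) =
      leftTranslation s * leftTranslation t := by
  refine ContinuousLinearMap.ext fun ξ => lp.ext (funext fun r => ?_)
  simp [mul_assoc]

theorem leftTranslation_one [Group Γ] :
    (leftTranslation (1 : Γ) : EllTwo Γ H →L[ℂ] EllTwo Γ H) = 1 := by
  refine ContinuousLinearMap.ext fun ξ => lp.ext (funext fun r => ?_)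
  simp

theorem leftTranslation_pointVector [Group Γ] (s t : Γ) (v : H) :
    leftTranslation s (pointVector t v) = pointVector (s * t) v := by
  refine lp.ext (funext fun r => ?_)
  rw [leftTranslation_apply]
  by_cases h : r = s * t
  · subst h
    rw [inv_mul_cancel_left, pointVector_apply_self, pointVector_apply_self]
  · rw [pointVector_apply_of_ne h, pointVector_apply_of_ne fun h' => h (by simp [← h'])]

/-- A translation moving the complement of `V` into `V` has no corner on that complement. -/
theorem norm_inner_leftTranslation_le [Group Γ] {g : Γ} {V : Set Γ} (hV : ∀ t ∉ V, g * t ∈ V)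
    (ξ η : EllTwo Γ H) :
    ‖inner ℂ (leftTranslation g ξ) η‖ ≤ ‖ξ‖ * ‖cutoff V η‖ + ‖cutoff V ξ‖ * ‖η‖ := by
  classical
  have h1 : inner ℂ (leftTranslation g (ξ - cutoff V ξ)) η =
      inner ℂ (leftTranslation g (ξ - cutoff V ξ)) (cutoff V η) := by
    rw [lp.inner_eq_tsum, lp.inner_eq_tsum]
    refine tsum_congr fun t => ?_
    rw [cutoff_apply]
    split_ifs with ht
    · rfl
    · have : g⁻¹ * t ∈ V := by
        by_contra h
        exact ht (by simpa using hV _ h)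
      rw [leftTranslation_apply, lp.coeFn_sub, Pi.sub_apply, cutoff_apply, if_pos this]
      simp
  have h2 : leftTranslation g ξ =
      leftTranslation g (ξ - cutoff V ξ) + leftTranslation g (cutoff V ξ) := by
    rw [← map_add, sub_add_cancel]
  rw [h2, inner_add_left, h1]
  refine (norm_add_le _ _).trans (add_le_add ?_ ?_)
  · refine (norm_inner_le_norm _ _).trans ?_
    rw [norm_leftTranslation_apply]
    exact mul_le_mul_of_nonneg_right (norm_sub_cutoff_le V ξ) (norm_nonneg _)
  · refine (norm_inner_le_norm _ _).trans ?_
    rw [norm_leftTranslation_apply]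

/-- An average of translations is small in norm if the `k`-th translation moves the complement of
`V k` into `V k` and the sets `V k` hardly overlap; this is the estimate behind the simplicity of
Powers groups. -/
theorem norm_sum_smul_leftTranslation_le [Group Γ] {κ : Type*} [Fintype κ] {w : κ → ℝ}
    (hw : ∀ k, 0 ≤ w k) (hw1 : ∑ k, w k = 1) (g : κ → Γ) (V : κ → Set Γ)
    (hV : ∀ k, ∀ t ∉ V k, g k * t ∈ V k) {δ : ℝ}
    (hδ : ∀ t, ∑ k, w k * (V k).indicator 1 t ≤ δ) :
    ‖∑ k, (w k : ℂ) • (leftTranslation (g k) : EllTwo Γ H →L[ℂ] EllTwo Γ H)‖ ≤ 2 * √δ := by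
  refine ContinuousLinearMap.opNorm_le_bound _ (by positivity) fun ξ => ?_
  set η := (∑ k, (w k : ℂ) • (leftTranslation (g k) : EllTwo Γ H →L[ℂ] EllTwo Γ H)) ξ with hη
  have hexp : ∀ ζ, inner ℂ η ζ = ∑ k, (w k : ℂ) * inner ℂ (leftTranslation (g k) ξ) ζ := by
    intro ζ
    rw [hη, sum_apply, sum_inner]
    refine Finset.sum_congr rfl fun k _ => ?_
    rw [smul_apply, inner_smul_left, Complex.conj_ofReal]
  have h1 : ‖η‖ ^ 2 ≤ (2 * √δ * ‖ξ‖) * ‖η‖ := by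
    have h2 : ‖η‖ ^ 2 = ‖inner ℂ η η‖ := by
      rw [inner_self_eq_norm_sq_to_K]
      simp
    calc ‖η‖ ^ 2 = ‖inner ℂ η η‖ := h2
      _ = ‖∑ k, (w k : ℂ) * inner ℂ (leftTranslation (g k) ξ) η‖ := by
          rw [← hexp]
      _ ≤ ∑ k, w k * (‖ξ‖ * ‖cutoff (V k) η‖ + ‖cutoff (V k) ξ‖ * ‖η‖) := by
          refine (norm_sum_le _ _).trans (Finset.sum_le_sum fun k _ => ?_)
          rw [norm_mul, Complex.norm_real, Real.norm_of_nonneg (hw k)]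
          exact mul_le_mul_of_nonneg_left (norm_inner_leftTranslation_le (hV k) ξ η) (hw k)
      _ = ‖ξ‖ * (∑ k, w k * ‖cutoff (V k) η‖) + (∑ k, w k * ‖cutoff (V k) ξ‖) * ‖η‖ := by
          rw [Finset.mul_sum, Finset.sum_mul, ← Finset.sum_add_distrib]
          exact Finset.sum_congr rfl fun k _ => by ring
      _ ≤ ‖ξ‖ * (√δ * ‖η‖) + (√δ * ‖ξ‖) * ‖η‖ := add_le_add
          (mul_le_mul_of_nonneg_left (sum_mul_norm_cutoff_le hw hw1 V hδ η) (norm_nonneg _))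
          (mul_le_mul_of_nonneg_right (sum_mul_norm_cutoff_le hw hw1 V hδ ξ) (norm_nonneg _))
      _ = _ := by ring
  rcases (norm_nonneg η).eq_or_lt with h0 | h0
  · rw [← h0]
    positivity
  · rw [sq] at h1
    exact le_of_mul_le_mul_right h1 h0

end Operators

/-! ### Averages of conjugates along strongly proximal nets -/

section Boundary

variable {Γ : Type*} [Group Γ] {Z : Type*} [TopologicalSpace Z] [T2Space Z]
  [MulAction Γ Z] [ContinuousConstSMul Γ Z]

/-- In a minimal topologically free flow the orbit of every point contains a point that is moved by
finitely many prescribed nontrivial elements. -/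
theorem exists_smul_not_fixed [CompactSpace Z] [Nonempty Z] (hmin : MulAction.IsMinimal Γ Z)
    (hfree : IsTopologicallyFree Γ Z) (F : Finset Γ) (z₀ : Z) :
    ∃ h : Γ, ∀ γ ∈ F, γ ≠ 1 → γ • h • z₀ ≠ h • z₀ := by
  have hdense : Dense (⋂ γ ∈ {γ : Γ | γ ∈ F ∧ γ ≠ 1}, (MulAction.fixedBy Z γ)ᶜ) := by
    refine dense_biInter_of_isOpen (fun γ _ => ?_) ?_ fun γ hγ => ?_
    · exact (isClosed_eq (continuous_const_smul γ) continuous_id).isOpen_compl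
    · exact (F.finite_toSet.subset fun γ hγ => hγ.1).countable
    · exact interior_eq_empty_iff_dense_compl.1 (hfree γ hγ.2)
  have hopen : IsOpen (⋂ γ ∈ {γ : Γ | γ ∈ F ∧ γ ≠ 1}, (MulAction.fixedBy Z γ)ᶜ) :=
    (F.finite_toSet.subset fun γ hγ => hγ.1).isOpen_biInter fun γ _ =>
      (isClosed_eq (continuous_const_smul γ) continuous_id).isOpen_compl
  obtain ⟨_, hz, ⟨h, rfl⟩⟩ := (hmin.dense_orbit z₀).inter_open_nonempty _ hopen hdense.nonempty
  exact ⟨h, fun γ hγ h1 hfix => Set.mem_iInter₂.1 hz γ ⟨hγ, h1⟩ hfix⟩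

/-- A point moved by finitely many group elements has a neighbourhood disjoint from its images under
these elements. -/
theorem exists_isOpen_forall_smul_notMem {F : Set Γ} (hF : F.Finite) {z₀ : Z}
    (hz : ∀ γ ∈ F, γ • z₀ ≠ z₀) :
    ∃ U : Set Z, IsOpen U ∧ z₀ ∈ U ∧ ∀ γ ∈ F, ∀ z ∈ U, γ • z ∉ U := by
  have h : ∀ γ ∈ F, ∃ U : Set Z, IsOpen U ∧ z₀ ∈ U ∧ ∀ z ∈ U, γ • z ∉ U := by
    intro γ hγ
    obtain ⟨A, B, hA, hB, hzA, hzB, hAB⟩ := t2_separation (hz γ hγ)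
    exact ⟨B ∩ (fun z => γ • z) ⁻¹' A, hB.inter (hA.preimage (continuous_const_smul γ)),
      ⟨hzB, hzA⟩, fun z hz hz' => Set.disjoint_left.1 hAB hz.2 hz'.1⟩
  choose! U hUo hzU hU using h
  refine ⟨⋂ γ ∈ F, U γ, hF.isOpen_biInter hUo, Set.mem_iInter₂.2 hzU, fun γ hγ z hz hz' => ?_⟩
  exact hU γ hγ z (Set.mem_iInter₂.1 hz γ hγ) (Set.mem_iInter₂.1 hz' γ hγ)

/-- Along a strongly proximal net `s` on a topologically free boundary, averages of the conjugates
`s'⁻¹ γ s'` of finitely many nontrivial elements `γ` tend to `0` in the reduced group C⋆-algebra.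
Here `s' = h⁻¹ s h` is strongly proximal with limit point `h⁻¹ z₀`, and `h` is chosen to make this
point free for the given elements. -/
theorem exists_average_conj_small {H : Type*} [NormedAddCommGroup H] [InnerProductSpace ℂ H]
    [CompactSpace Z] [MeasurableSpace Z] [BorelSpace Z] (hZ : IsBoundary Γ Z)
    (hfree : IsTopologicallyFree Γ Z)
    {ι : Type*} {l : Filter ι} [l.NeBot] {s : ι → Γ} (hs : IsStronglyProximalNet Z l s)
    (F : Finset Γ) :
    ∃ h : Γ, ∀ S ∈ l, ∀ ε > 0, ∃ (κ : Type) (_ : Fintype κ) (w : κ → ℝ) (j : κ → ι),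
      (∀ k, 0 ≤ w k) ∧ ∑ k, w k = 1 ∧ (∀ k, j k ∈ S) ∧ ∀ γ ∈ F, γ ≠ 1 →
        ‖∑ k, (w k : ℂ) • (leftTranslation ((h⁻¹ * s (j k) * h)⁻¹ * γ * (h⁻¹ * s (j k) * h)) :
          EllTwo Γ H →L[ℂ] EllTwo Γ H)‖ ≤ ε := by
  have := hZ.nonempty
  obtain ⟨z₀, hz₀⟩ := hs
  obtain ⟨g, hg⟩ := exists_smul_not_fixed hZ.minimal hfree F z₀
  obtain ⟨U, hUo, hzU, hU⟩ := exists_isOpen_forall_smul_notMem (z₀ := g • z₀)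
    (F := {γ | γ ∈ F ∧ γ ≠ 1}) (F.finite_toSet.subset fun γ hγ => hγ.1)
    (fun γ hγ => hg γ hγ.1 hγ.2)
  obtain ⟨f, hf0, hf1, hf⟩ := exists_continuous_zero_one_of_isClosed
    (isClosed_singleton (x := g • z₀)) hUo.isClosed_compl (by simpa using hzU)
  refine ⟨g⁻¹, fun S hS ε hε => ?_⟩
  let f' : C(Z, ℝ) := f.comp ⟨fun z => g • z, continuous_const_smul g⟩
  have hlim : ∀ ν : Measure Z, IsProbabilityMeasure ν → ν.Regular →
      Tendsto (fun i => ∫ z, f'.comp ⟨fun z => s i • z, continuous_const_smul (s i)⟩ z ∂ν) l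
        (𝓝 0) := by
    intro ν hν hνr
    have h1 := hz₀ ν hν hνr f'
    have h2 : f' z₀ = 0 := hf0 rfl
    rw [h2] at h1
    refine h1.congr fun i => ?_
    rw [integral_map (continuous_const_smul (s i)).measurable.aemeasurable
      f'.continuous.aestronglyMeasurable]
    rfl
  obtain ⟨κ, hκ, w, j, hw, hw1, hj, hsmall⟩ := exists_convexCombination_lt_of_tendsto_integral _
    hlim hS (show 0 < (ε / 2) ^ 2 by positivity)
  refine ⟨κ, hκ, w, j, hw, hw1, hj, fun γ hγ hγ1 => ?_⟩
  obtain ⟨z₁⟩ := hZ.nonempty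
  classical
  -- the sets of the averaging estimate, pulled back to `Γ` along the orbit of `z₁`
  let V : κ → Set Γ := fun k => {t | (g * s (j k) * g⁻¹) • t • z₁ ∉ U}
  have hbound := norm_sum_smul_leftTranslation_le (H := H) hw hw1
    (fun k => (g⁻¹⁻¹ * s (j k) * g⁻¹)⁻¹ * γ * (g⁻¹⁻¹ * s (j k) * g⁻¹)) V
    (fun k t ht => by
      have := hU γ ⟨hγ, hγ1⟩ _ (not_not.1 ht)
      simpa [V, smul_smul, mul_assoc] using this) (δ := (ε / 2) ^ 2) (fun t => by
      refine le_trans (Finset.sum_le_sum fun k _ => ?_) (hsmall (g⁻¹ • t • z₁)).le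
      refine mul_le_mul_of_nonneg_left ?_ (hw k)
      rw [Set.indicator_apply]
      split_ifs with ht
      · exact (hf1 (by simpa [V, smul_smul, mul_assoc] using ht)).ge.trans_eq
          (by simp [f', smul_smul])
      · exact (hf _).1)
  rwa [Real.sqrt_sq (by positivity), mul_div_cancel₀ _ two_ne_zero] at hbound

end Boundary

/-! ### Averages of conjugates of an operator -/

section ConjAverage

variable {Γ H : Type*} [Group Γ] [NormedAddCommGroup H] [InnerProductSpace ℂ H]
  {κ : Type*} [Fintype κ]

/-- The average `∑ w_k λ_{g_k}⁻¹ T λ_{g_k}` of conjugates of an operator `T` by left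
translations. -/
noncomputable def conjAverage (w : κ → ℝ) (g : κ → Γ) :
    (EllTwo Γ H →L[ℂ] EllTwo Γ H) →ₗ[ℂ] (EllTwo Γ H →L[ℂ] EllTwo Γ H) :=
  ∑ k, (w k : ℂ) • LinearMap.mulLeftRight ℂ (leftTranslation (g k)⁻¹, leftTranslation (g k))

theorem conjAverage_apply (w : κ → ℝ) (g : κ → Γ) (T : EllTwo Γ H →L[ℂ] EllTwo Γ H) :
    conjAverage w g T =
      ∑ k, (w k : ℂ) • (leftTranslation (g k)⁻¹ * T * leftTranslation (g k)) := by
  simp [conjAverage, LinearMap.sum_apply]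

theorem norm_sum_smul_le {E : Type*} [NormedAddCommGroup E] [NormedSpace ℂ E] {w : κ → ℝ}
    (hw : ∀ k, 0 ≤ w k) (hw1 : ∑ k, w k = 1) {x : κ → E} {C : ℝ} (hx : ∀ k, ‖x k‖ ≤ C) :
    ‖∑ k, (w k : ℂ) • x k‖ ≤ C := by
  calc ‖∑ k, (w k : ℂ) • x k‖ ≤ ∑ k, w k * C := by
        refine (norm_sum_le _ _).trans (Finset.sum_le_sum fun k _ => ?_)
        rw [norm_smul, Complex.norm_real, Real.norm_of_nonneg (hw k)]
        exact mul_le_mul_of_nonneg_left (hx k) (hw k)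
    _ = C := by rw [← Finset.sum_mul, hw1, one_mul]

theorem norm_conjAverage_le {w : κ → ℝ} (hw : ∀ k, 0 ≤ w k) (hw1 : ∑ k, w k = 1) (g : κ → Γ)
    (T : EllTwo Γ H →L[ℂ] EllTwo Γ H) : ‖conjAverage w g T‖ ≤ ‖T‖ := by
  rw [conjAverage_apply]
  refine norm_sum_smul_le (E := EllTwo Γ H →L[ℂ] EllTwo Γ H) hw hw1 fun k => ?_
  refine ContinuousLinearMap.opNorm_le_bound _ (norm_nonneg T) fun ξ => ?_
  change ‖leftTranslation (g k)⁻¹ (T (leftTranslation (g k) ξ))‖ ≤ _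
  rw [norm_leftTranslation_apply, ← norm_leftTranslation_apply (g k) ξ]
  exact T.le_opNorm _

theorem conjAverage_mem {S : Type*} [SetLike S (EllTwo Γ H →L[ℂ] EllTwo Γ H)]
    [SubsemiringClass S (EllTwo Γ H →L[ℂ] EllTwo Γ H)]
    [SMulMemClass S ℂ (EllTwo Γ H →L[ℂ] EllTwo Γ H)] {A : S}
    (hA : ∀ s : Γ, leftTranslation s ∈ A) (w : κ → ℝ) (g : κ → Γ)
    {T : EllTwo Γ H →L[ℂ] EllTwo Γ H} (hT : T ∈ A) : conjAverage w g T ∈ A := by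
  rw [conjAverage_apply]
  exact sum_mem fun k _ => SMulMemClass.smul_mem _ (mul_mem (mul_mem (hA _) hT) (hA _))

end ConjAverage

section Adjoint

variable {Γ H : Type*} [NormedAddCommGroup H] [InnerProductSpace ℂ H] [CompleteSpace H]

theorem star_leftTranslation [Group Γ] (s : Γ) :
    star (leftTranslation s : EllTwo Γ H →L[ℂ] EllTwo Γ H) = leftTranslation s⁻¹ := by
  rw [ContinuousLinearMap.star_eq_adjoint, eq_comm, ContinuousLinearMap.eq_adjoint_iff]
  intro ξ η
  rw [lp.inner_eq_tsum, lp.inner_eq_tsum, ← (Equiv.mulLeft s⁻¹).tsum_eq]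
  exact tsum_congr fun t => by simp

theorem star_diagonalOp (D D' : lp (fun _ : Γ => H →L[ℂ] H) ∞) (h : ∀ t, D' t = star (D t)) :
    star (diagonalOp D) = diagonalOp D' := by
  rw [ContinuousLinearMap.star_eq_adjoint, eq_comm, ContinuousLinearMap.eq_adjoint_iff]
  intro ξ η
  rw [lp.inner_eq_tsum, lp.inner_eq_tsum]
  refine tsum_congr fun t => ?_
  rw [diagonalOp_apply, diagonalOp_apply, h, ContinuousLinearMap.star_eq_adjoint,
    ContinuousLinearMap.adjoint_inner_left]

end Adjoint

/-! ### The reduced crossed product -/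

section Topological

theorem invTranslate_mul {Γ X : Type*} [Group Γ] [TopologicalSpace X] [MulAction Γ X]
    [ContinuousConstSMul Γ X] (s t : Γ) (a : C(X, ℂ)) :
    invTranslate (s * t) a = invTranslate t (invTranslate s a) := by
  ext x
  simp [invTranslate, mul_smul]

variable {Γ : Type*} [Group Γ] {H : Type*} [NormedAddCommGroup H] [InnerProductSpace ℂ H]
  [CompleteSpace H] {X : Type*} [TopologicalSpace X] [CompactSpace X] [MulAction Γ X]
  [ContinuousConstSMul Γ X] (π : C(X, ℂ) →⋆ₐ[ℂ] (H →L[ℂ] H))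

theorem coeffOp_apply (a : C(X, ℂ)) (ξ : EllTwo Γ H) (t : Γ) :
    coeffOp Γ π a ξ t = π (invTranslate t a) (ξ t) := rfl

theorem coeffOp_add (a b : C(X, ℂ)) : coeffOp Γ π (a + b) = coeffOp Γ π a + coeffOp Γ π b := by
  refine ContinuousLinearMap.ext fun ξ => lp.ext (funext fun t => ?_)
  have : invTranslate t (a + b) = invTranslate t a + invTranslate t b := rfl
  simp [coeffOp_apply, this, map_add]

theorem coeffOp_smul (c : ℂ) (a : C(X, ℂ)) : coeffOp Γ π (c • a) = c • coeffOp Γ π a := by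
  refine ContinuousLinearMap.ext fun ξ => lp.ext (funext fun t => ?_)
  have : invTranslate t (c • a) = c • invTranslate t a := rfl
  simp [coeffOp_apply, this, map_smul]

theorem coeffOp_mul (a b : C(X, ℂ)) : coeffOp Γ π (a * b) = coeffOp Γ π a * coeffOp Γ π b := by
  refine ContinuousLinearMap.ext fun ξ => lp.ext (funext fun t => ?_)
  have : invTranslate t (a * b) = invTranslate t a * invTranslate t b := rfl
  simp [coeffOp_apply, this, map_mul]

theorem coeffOp_one : coeffOp Γ π (1 : C(X, ℂ)) = 1 := by
  refine ContinuousLinearMap.ext fun ξ => lp.ext (funext fun t => ?_)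
  have : invTranslate t (1 : C(X, ℂ)) = 1 := rfl
  simp [coeffOp_apply, this]

theorem star_coeffOp (a : C(X, ℂ)) : star (coeffOp Γ π a) = coeffOp Γ π (star a) :=
  star_diagonalOp _ _ fun t => by
    rw [← map_star]
    rfl

theorem leftTranslation_mul_coeffOp (s : Γ) (a : C(X, ℂ)) :
    leftTranslation s * coeffOp Γ π a =
      coeffOp Γ π (invTranslate s⁻¹ a) * leftTranslation s := by
  refine ContinuousLinearMap.ext fun ξ => lp.ext (funext fun t => ?_)
  change coeffOp Γ π a ξ (s⁻¹ * t) = coeffOp Γ π (invTranslate s⁻¹ a) (leftTranslation s ξ) t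
  rw [coeffOp_apply, coeffOp_apply, invTranslate_mul, leftTranslation_apply]

theorem norm_coeffOp_le (a : C(X, ℂ)) : ‖coeffOp Γ π a‖ ≤ ‖a‖ := by
  refine (norm_diagonalOp_le _).trans (lp.norm_le_of_forall_le (norm_nonneg a) fun t => ?_)
  refine (NonUnitalStarAlgHom.norm_apply_le π _).trans ?_
  exact (ContinuousMap.norm_le _ (norm_nonneg a)).2 fun x => a.norm_coe_le_norm _

variable (Γ) in
/-- The operator `∑ σ(a_γ) λ_γ` given by finitely many coefficients `a_γ ∈ C(X)`. -/
noncomputable def crossedSum : (Γ →₀ C(X, ℂ)) →ₗ[ℂ] (EllTwo Γ H →L[ℂ] EllTwo Γ H) :=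
  Finsupp.lsum ℂ fun γ : Γ =>
    { toFun := fun a => coeffOp Γ π a * leftTranslation γ
      map_add' := fun a b => by rw [coeffOp_add, add_mul]
      map_smul' := fun c a => by rw [coeffOp_smul, smul_mul_assoc]; rfl }

theorem crossedSum_single (γ : Γ) (a : C(X, ℂ)) :
    crossedSum Γ π (Finsupp.single γ a) = coeffOp Γ π a * leftTranslation γ := by
  rw [crossedSum, Finsupp.lsum_single]
  rfl

theorem crossedSum_apply (a : Γ →₀ C(X, ℂ)) :
    crossedSum Γ π a = ∑ γ ∈ a.support, coeffOp Γ π (a γ) * leftTranslation γ := by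
  simp [crossedSum, Finsupp.sum]

theorem mul_mem_range_crossedSum (a b : Γ →₀ C(X, ℂ)) :
    crossedSum Γ π a * crossedSum Γ π b ∈ LinearMap.range (crossedSum (H := H) Γ π) := by
  induction a using Finsupp.induction_linear with
  | zero => simp
  | add a a' h h' => rw [map_add, add_mul]; exact add_mem h h'
  | single γ a =>
    induction b using Finsupp.induction_linear with
    | zero => simp
    | add b b' h h' => rw [map_add, mul_add]; exact add_mem h h'
    | single δ b =>
      refine ⟨Finsupp.single (γ * δ) (a * invTranslate γ⁻¹ b), ?_⟩
      rw [crossedSum_single, crossedSum_single, crossedSum_single, mul_assoc,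
        ← mul_assoc (leftTranslation γ), leftTranslation_mul_coeffOp, coeffOp_mul,
        leftTranslation_mul]
      simp only [mul_assoc]

theorem star_mem_range_crossedSum (a : Γ →₀ C(X, ℂ)) :
    star (crossedSum Γ π a) ∈ LinearMap.range (crossedSum (H := H) Γ π) := by
  induction a using Finsupp.induction_linear with
  | zero => simp
  | add a a' h h' => rw [map_add, star_add]; exact add_mem h h'
  | single γ a =>
    refine ⟨Finsupp.single γ⁻¹ (invTranslate γ⁻¹⁻¹ (star a)), ?_⟩
    rw [crossedSum_single, crossedSum_single, star_mul, star_leftTranslation, star_coeffOp,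
      leftTranslation_mul_coeffOp]

/-- The finite sums `∑ σ(a_γ) λ_γ` are norm dense in the reduced crossed product. -/
theorem exists_crossedSum_near {T : EllTwo Γ H →L[ℂ] EllTwo Γ H}
    (hT : T ∈ reducedCrossedProduct Γ π) {ε : ℝ} (hε : 0 < ε) :
    ∃ a : Γ →₀ C(X, ℂ), ‖T - crossedSum Γ π a‖ < ε := by
  have hcl : T ∈ closure ((StarAlgebra.adjoin ℂ (Set.range (coeffOp Γ π) ∪
      Set.range fun s : Γ => leftTranslation (H := H) s) :
        StarSubalgebra ℂ (EllTwo Γ H →L[ℂ] EllTwo Γ H)) : Set _) := by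
    rw [← StarSubalgebra.topologicalClosure_coe]
    exact hT
  obtain ⟨y, hy, hTy⟩ := Metric.mem_closure_iff.1 hcl ε hε
  have hyr : y ∈ LinearMap.range (crossedSum (H := H) Γ π) := by
    clear hTy
    induction hy using StarAlgebra.adjoin_induction with
    | mem x hx =>
      rcases hx with ⟨a, rfl⟩ | ⟨s, rfl⟩
      · exact ⟨Finsupp.single 1 a, by rw [crossedSum_single, leftTranslation_one, mul_one]⟩
      · exact ⟨Finsupp.single s 1, by rw [crossedSum_single, coeffOp_one, one_mul]⟩
    | algebraMap r =>
      refine ⟨r • Finsupp.single 1 1, ?_⟩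
      rw [map_smul, crossedSum_single, coeffOp_one, leftTranslation_one, one_mul,
        Algebra.algebraMap_eq_smul_one]
    | add x y _ _ hx hy => exact add_mem hx hy
    | mul x y _ _ hx hy =>
      obtain ⟨a, rfl⟩ := hx
      obtain ⟨b, rfl⟩ := hy
      exact mul_mem_range_crossedSum π a b
    | star x _ hx =>
      obtain ⟨a, rfl⟩ := hx
      exact star_mem_range_crossedSum π a
  obtain ⟨a, rfl⟩ := hyr
  exact ⟨a, by rwa [← dist_eq_norm]⟩

theorem diagonalPart_crossedSum (a : Γ →₀ C(X, ℂ)) :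
    diagonalPart (crossedSum Γ π a) = coeffOp Γ π (a 1) := by
  classical
  induction a using Finsupp.induction_linear with
  | zero =>
    have h : coeffOp Γ π (0 : C(X, ℂ)) = 0 := by simpa using coeffOp_smul (Γ := Γ) π 0 0
    have h' : diagonalPart (0 : EllTwo Γ H →L[ℂ] EllTwo Γ H) = 0 := by
      simpa using diagonalPart_smul 0 (0 : EllTwo Γ H →L[ℂ] EllTwo Γ H)
    simp [h, h']
  | add a b ha hb => rw [map_add, diagonalPart_add, ha, hb, Finsupp.add_apply, coeffOp_add]
  | single γ a =>
    rw [crossedSum_single, diagonalPart_coeffOp_mul, Finsupp.single_apply]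
    split_ifs
    · rfl
    · simpa using (coeffOp_smul (Γ := Γ) π 0 0).symm

theorem conjAverage_coeffOp_mul {κ : Type*} [Fintype κ] (w : κ → ℝ) (g : κ → Γ) (a : C(X, ℂ))
    (γ : Γ) :
    conjAverage w g (coeffOp Γ π a * leftTranslation γ) =
      ∑ k, (w k : ℂ) •
        (coeffOp Γ π (invTranslate (g k) a) * leftTranslation ((g k)⁻¹ * γ * g k)) := by
  rw [conjAverage_apply]
  refine Finset.sum_congr rfl fun k _ => ?_
  rw [← mul_assoc, leftTranslation_mul_coeffOp, inv_inv, leftTranslation_mul,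
    leftTranslation_mul]
  simp only [mul_assoc]

/-- If the `g k` almost fix `a`, then averaging `σ(a) λ_γ` only affects the unitary `λ_γ`, up to a
small error. -/
theorem norm_conjAverage_coeffOp_mul_sub_le {κ : Type*} [Fintype κ] {w : κ → ℝ}
    (hw : ∀ k, 0 ≤ w k) (hw1 : ∑ k, w k = 1) (g : κ → Γ) (a : C(X, ℂ)) (γ : Γ) {δ : ℝ}
    (hδ : ∀ k, ‖invTranslate (g k) a - a‖ ≤ δ) :
    ‖conjAverage w g (coeffOp Γ π a * leftTranslation γ) -
      coeffOp Γ π a * ∑ k, (w k : ℂ) • leftTranslation ((g k)⁻¹ * γ * g k)‖ ≤ δ := by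
  rw [conjAverage_coeffOp_mul, Finset.mul_sum, ← Finset.sum_sub_distrib]
  have h : ∀ k, (w k : ℂ) • (coeffOp Γ π (invTranslate (g k) a) *
        leftTranslation ((g k)⁻¹ * γ * g k)) -
      coeffOp Γ π a * (w k : ℂ) • leftTranslation ((g k)⁻¹ * γ * g k) =
      (w k : ℂ) • (coeffOp Γ π (invTranslate (g k) a - a) *
        leftTranslation ((g k)⁻¹ * γ * g k)) := by
    intro k
    have h1 : coeffOp Γ π (invTranslate (g k) a - a) =
        coeffOp Γ π (invTranslate (g k) a) - coeffOp Γ π a := by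
      rw [eq_sub_iff_add_eq, ← coeffOp_add, sub_add_cancel]
    rw [h1, sub_mul, smul_sub, mul_smul_comm]
  simp only [h]
  refine norm_sum_smul_le hw hw1 fun k => (norm_mul_le _ _).trans ?_
  calc _ ≤ δ * 1 := mul_le_mul ((norm_coeffOp_le π _).trans (hδ k)) (norm_leftTranslation_le _)
        (norm_nonneg _) ((norm_nonneg _).trans (hδ k))
    _ = δ := mul_one δ

end Topological

/-! ### Intermediate C⋆-algebras -/

section AlmostReflecting

variable {Γ : Type*} [Group Γ] {X : Type*} [UniformSpace X] [CompactSpace X] [MulAction Γ X]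
  [ContinuousConstSMul Γ X]

theorem IsRigidNet.eventually_norm_invTranslate_sub_le {ι : Type*} {l : Filter ι} {s : ι → Γ}
    (hs : IsRigidNet X l s) (h : Γ) (a : C(X, ℂ)) {δ : ℝ} (hδ : 0 < δ) :
    ∀ᶠ i in l, ‖invTranslate (h⁻¹ * s i * h) a - a‖ ≤ δ := by
  have huc : UniformContinuous (invTranslate h⁻¹ a) :=
    CompactSpace.uniformContinuous_of_continuous (invTranslate h⁻¹ a).continuous
  have := huc.comp_tendstoUniformly hs.tendsto
  filter_upwards [Metric.tendstoUniformly_iff.1 this δ hδ] with i hi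
  refine (ContinuousMap.norm_le _ hδ.le).2 fun x => ?_
  have h1 := hi (h • x)
  rw [dist_comm, dist_eq_norm] at h1
  simpa [invTranslate, mul_smul] using h1.le

/-- A net that is rigid on the flow `X` and strongly proximal on a topologically free boundary
provides averages of conjugates that converge to the conditional expectation. -/
theorem isAlmostReflecting_of_rigid_of_proximal
    {Z : Type*} [TopologicalSpace Z] [CompactSpace Z] [T2Space Z]
    [MeasurableSpace Z] [BorelSpace Z] [MulAction Γ Z] [ContinuousConstSMul Γ Z]
    (hZ : IsBoundary Γ Z) (hfree : IsTopologicallyFree Γ Z)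
    {ι : Type*} {l : Filter ι} [l.NeBot] {s : ι → Γ}
    (hrig : IsRigidNet X l s) (hprox : IsStronglyProximalNet Z l s)
    {H : Type*} [NormedAddCommGroup H] [InnerProductSpace ℂ H] [CompleteSpace H]
    (π : C(X, ℂ) →⋆ₐ[ℂ] (H →L[ℂ] H)) : IsAlmostReflecting Γ π := by
  intro A hAcl hA hAX T hT
  have hL : ∀ s : Γ, leftTranslation s ∈ A := fun s =>
    hA (StarSubalgebra.le_topologicalClosure _ (StarAlgebra.subset_adjoin ℂ _ ⟨s, rfl⟩))
  have hcl : diagonalPart T ∈ closure (A : Set (EllTwo Γ H →L[ℂ] EllTwo Γ H)) := by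
    refine Metric.mem_closure_iff.2 fun ε hε => ?_
    obtain ⟨a, ha⟩ := exists_crossedSum_near π (hAX hT) (show 0 < ε / 4 by positivity)
    obtain ⟨h, hh⟩ := exists_average_conj_small (H := H) hZ hfree hprox a.support
    -- each of the finitely many terms `σ(a γ) λ_γ` contributes an error of at most
    -- `δ * (1 + ‖a γ‖)`
    let C : ℝ := ∑ γ ∈ a.support, (1 + ‖a γ‖)
    have hC : 0 ≤ C := Finset.sum_nonneg fun γ _ => by positivity
    let δ : ℝ := ε / (4 * (1 + C))
    have hδ : 0 < δ := by positivity
    have hδC : δ * C ≤ ε / 4 := by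
      have : δ * (4 * (1 + C)) = ε := div_mul_cancel₀ _ (by positivity)
      nlinarith
    have hev : ∀ᶠ i in l, ∀ γ ∈ a.support,
        ‖invTranslate (h⁻¹ * s i * h) (a γ) - a γ‖ ≤ δ :=
      (Finset.eventually_all _).2 fun γ _ => hrig.eventually_norm_invTranslate_sub_le h (a γ) hδ
    obtain ⟨κ, hκ, w, j, hw, hw1, hj, hsmall⟩ := hh _ hev δ hδ
    let g : κ → Γ := fun k => h⁻¹ * s (j k) * h
    refine ⟨conjAverage w g T, conjAverage_mem hL w g hT, ?_⟩
    have hmain : ‖conjAverage w g (crossedSum Γ π a) - diagonalPart (crossedSum Γ π a)‖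
        ≤ δ * C := by
      classical
      have hdiag : diagonalPart (crossedSum Γ π a) =
          ∑ γ ∈ a.support, if γ = 1 then coeffOp Γ π (a γ) else 0 := by
        rw [diagonalPart_crossedSum, Finset.sum_ite_eq']
        split_ifs with h1
        · rfl
        · rw [Finsupp.notMem_support_iff.1 h1]
          simpa using coeffOp_smul (Γ := Γ) π 0 0
      rw [hdiag, crossedSum_apply, map_sum, ← Finset.sum_sub_distrib, Finset.mul_sum]
      refine (norm_sum_le _ _).trans (Finset.sum_le_sum fun γ hγ => ?_)
      have h1 := norm_conjAverage_coeffOp_mul_sub_le π hw hw1 g (a γ) γ (fun k => hj k γ hγ)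
      have h2 : ‖coeffOp Γ π (a γ) * ∑ k, (w k : ℂ) • leftTranslation ((g k)⁻¹ * γ * g k) -
          if γ = 1 then coeffOp Γ π (a γ) else 0‖ ≤ ‖a γ‖ * δ := by
        split_ifs with hγ1
        · have h3 : ∑ k, (w k : ℂ) • (leftTranslation ((g k)⁻¹ * γ * g k) :
              EllTwo Γ H →L[ℂ] EllTwo Γ H) = 1 := by
            simp only [hγ1, mul_one, inv_mul_cancel, leftTranslation_one, ← Finset.sum_smul]
            rw [← Complex.ofReal_sum, hw1, Complex.ofReal_one, one_smul]
          rw [h3, mul_one, sub_self, norm_zero]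
          positivity
        · rw [sub_zero]
          exact (norm_mul_le _ _).trans (mul_le_mul (norm_coeffOp_le π _) (hsmall γ hγ hγ1)
            (norm_nonneg _) (norm_nonneg _))
      calc _ ≤ δ + ‖a γ‖ * δ := norm_sub_le_norm_sub_add_norm_sub _ _ _ |>.trans (add_le_add h1 h2)
        _ = δ * (1 + ‖a γ‖) := by ring
    have e : diagonalPart T - conjAverage w g T =
        diagonalPart (T - crossedSum Γ π a) - conjAverage w g (T - crossedSum Γ π a) -
          (conjAverage w g (crossedSum Γ π a) - diagonalPart (crossedSum Γ π a)) := by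
      rw [diagonalPart_sub, map_sub]
      abel
    rw [dist_eq_norm, e]
    have n1 := norm_diagonalPart_le (T - crossedSum Γ π a)
    have n2 := norm_conjAverage_le hw hw1 g (T - crossedSum Γ π a)
    have n3 := norm_sub_le (diagonalPart (T - crossedSum Γ π a) -
      conjAverage w g (T - crossedSum Γ π a))
      (conjAverage w g (crossedSum Γ π a) - diagonalPart (crossedSum Γ π a))
    have n4 := norm_sub_le (diagonalPart (T - crossedSum Γ π a))
      (conjAverage w g (T - crossedSum Γ π a))
    linarith
  rwa [hAcl.closure_eq] at hcl

end AlmostReflecting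

/-! ### Von Neumann algebras -/

section VonNeumann

variable {K : Type*} [NormedAddCommGroup K] [InnerProductSpace ℂ K]

/-- The vectors on which a bounded family of operators converges to a given operator form a closed
set. -/
theorem isClosed_setOf_tendsto_apply {ι : Type*} {l : Filter ι} {x : ι → K →L[ℂ] K} {C : ℝ}
    (hx : ∀ i, ‖x i‖ ≤ C) (y : K →L[ℂ] K) : IsClosed {v | Tendsto (fun i => x i v) l (𝓝 (y v))} := by
  refine isClosed_of_closure_subset fun v hv => Metric.tendsto_nhds.2 fun ε hε => ?_
  have hpos : 0 < |C| + ‖y‖ + 1 := by positivity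
  obtain ⟨v', hv', hd⟩ := Metric.mem_closure_iff.1 hv (ε / (2 * (|C| + ‖y‖ + 1))) (by positivity)
  filter_upwards [Metric.tendsto_nhds.1 hv' (ε / 2) (by positivity)] with i h1
  rw [dist_eq_norm] at h1 hd ⊢
  have e : x i v - y v = x i (v - v') - y (v - v') + (x i v' - y v') := by
    rw [map_sub, map_sub]
    abel
  have h2 : ‖x i (v - v')‖ ≤ |C| * ‖v - v'‖ :=
    (x i).le_of_opNorm_le ((hx i).trans (le_abs_self C)) _
  have h3 : ‖y (v - v')‖ ≤ ‖y‖ * ‖v - v'‖ := y.le_opNorm _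
  have h4 : (|C| + ‖y‖ + 1) * ‖v - v'‖ < ε / 2 := by
    have := mul_lt_mul_of_pos_left hd hpos
    rwa [show (|C| + ‖y‖ + 1) * (ε / (2 * (|C| + ‖y‖ + 1))) = ε / 2 by field_simp] at this
  have h5 := norm_add_le (x i (v - v') - y (v - v')) (x i v' - y v')
  have h6 := norm_sub_le (x i (v - v')) (y (v - v'))
  have h7 := norm_nonneg (v - v')
  rw [e]
  linarith

variable [CompleteSpace K]

theorem mem_vonNeumannGenerated_iff {S : Set (K →L[ℂ] K)} {T : K →L[ℂ] K} :
    T ∈ vonNeumannGenerated S ↔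
      ∀ R : K →L[ℂ] K, (∀ a ∈ S, a * R = R * a ∧ star a * R = R * star a) → R * T = T * R := by
  change T ∈ StarSubalgebra.centralizer ℂ
    (StarSubalgebra.centralizer ℂ S : Set (K →L[ℂ] K)) ↔ _
  rw [StarSubalgebra.mem_centralizer_iff]
  constructor
  · intro h R hR
    exact (h R ((StarSubalgebra.mem_centralizer_iff ℂ).2 hR)).1
  · intro h R hR
    exact ⟨h R ((StarSubalgebra.mem_centralizer_iff ℂ).1 hR),
      h _ ((StarSubalgebra.mem_centralizer_iff ℂ).1 (star_mem hR))⟩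

theorem subset_vonNeumannGenerated (S : Set (K →L[ℂ] K)) :
    S ⊆ (vonNeumannGenerated S : Set (K →L[ℂ] K)) := fun a ha =>
  mem_vonNeumannGenerated_iff.2 fun _ hR => (hR a ha).1.symm

theorem VonNeumannAlgebra.mem_of_forall_commute {A : VonNeumannAlgebra K} {T : K →L[ℂ] K}
    (h : ∀ R : K →L[ℂ] K, (∀ a ∈ A, a * R = R * a) → R * T = T * R) : T ∈ A := by
  rw [← A.commutant_commutant, VonNeumannAlgebra.mem_commutant_iff]
  exact fun R hR => h R (VonNeumannAlgebra.mem_commutant_iff.1 hR)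

theorem vonNeumannGenerated_le {S : Set (K →L[ℂ] K)} {A : VonNeumannAlgebra K}
    (h : S ⊆ (A : Set (K →L[ℂ] K))) : vonNeumannGenerated S ≤ A := fun _ hT =>
  VonNeumannAlgebra.mem_of_forall_commute fun R hR =>
    mem_vonNeumannGenerated_iff.1 hT R fun a ha => ⟨hR a (h ha), hR _ (star_mem (h ha))⟩

/-- A von Neumann algebra is closed under strong limits of sequences. -/
theorem VonNeumannAlgebra.mem_of_tendsto {A : VonNeumannAlgebra K} {x : ℕ → K →L[ℂ] K}
    {y : K →L[ℂ] K} (hx : ∀ n, x n ∈ A)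
    (h : ∀ v, Tendsto (fun n => x n v) atTop (𝓝 (y v))) : y ∈ A := by
  refine VonNeumannAlgebra.mem_of_forall_commute fun R hR => ContinuousLinearMap.ext fun v => ?_
  refine tendsto_nhds_unique ((R.continuous.tendsto _).comp (h v)) ((h (R v)).congr fun n => ?_)
  exact congrArg (fun T : K →L[ℂ] K => T v) (hR _ (hx n))

theorem VonNeumannAlgebra.smul_mem {A : VonNeumannAlgebra K} (c : ℂ) {T : K →L[ℂ] K}
    (hT : T ∈ A) : c • T ∈ A :=
  A.toStarSubalgebra.smul_mem hT c

end VonNeumann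

/-! ### Multiplication operators -/

section Multiplication

variable {X : Type*} [MeasurableSpace X] {μ : Measure X}

theorem coeFn_mulOp (f : Lp ℂ ∞ μ) (v : Lp ℂ 2 μ) : mulOp μ f v =ᵐ[μ] fun x => f x * v x := by
  filter_upwards [ContinuousLinearMap.coeFn_holder (r := 2) (ContinuousLinearMap.mul ℂ ℂ) f v]
    with x hx
  exact hx

theorem enorm_sq_eq_lintegral (v : Lp ℂ 2 μ) : ‖v‖ₑ ^ 2 = ∫⁻ x, ‖v x‖ₑ ^ 2 ∂μ := by
  rw [Lp.enorm_def, eLpNorm_eq_lintegral_rpow_enorm_toReal (by simp) (by simp),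
    ← ENNReal.rpow_natCast, ← ENNReal.rpow_mul]
  simp

theorem norm_mulOp_le (f : Lp ℂ ∞ μ) : ‖mulOp μ f‖ ≤ ‖f‖ := by
  refine ContinuousLinearMap.opNorm_le_bound _ (norm_nonneg f) fun v => ?_
  refine (ContinuousLinearMap.norm_holder_apply_apply_le (r := 2)
    (ContinuousLinearMap.mul ℂ ℂ) f v).trans ?_
  have := ContinuousLinearMap.opNorm_mul_le ℂ ℂ
  gcongr
  nlinarith [norm_nonneg f]

theorem mulOp_comm (f g : Lp ℂ ∞ μ) (v : Lp ℂ 2 μ) :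
    mulOp μ f (mulOp μ g v) = mulOp μ g (mulOp μ f v) := by
  refine Lp.ext ?_
  filter_upwards [coeFn_mulOp f (mulOp μ g v), coeFn_mulOp g (mulOp μ f v), coeFn_mulOp f v,
    coeFn_mulOp g v] with x h1 h2 h3 h4
  rw [h1, h2, h3, h4]
  ring

theorem star_mulOp (f : Lp ℂ ∞ μ) : star (mulOp μ f) = mulOp μ (star f) := by
  rw [ContinuousLinearMap.star_eq_adjoint, eq_comm, ContinuousLinearMap.eq_adjoint_iff]
  intro v w
  rw [L2.inner_def, L2.inner_def]
  refine integral_congr_ae ?_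
  filter_upwards [coeFn_mulOp (star f) v, coeFn_mulOp f w, Lp.coeFn_star f] with x h1 h2 h3
  rw [h1, h2, h3]
  simp only [Pi.star_apply, RCLike.inner_apply, RCLike.star_def, map_mul, Complex.conj_conj]
  ring

variable [IsProbabilityMeasure μ]

variable (μ) in
/-- The constant function `1` in `L²(X, μ)`. -/
noncomputable def oneL2 : Lp ℂ 2 μ := Lp.const 2 μ 1

theorem coeFn_oneL2 : oneL2 μ =ᵐ[μ] fun _ => 1 := Lp.coeFn_const ..

theorem coeFn_mulOp_oneL2 (f : Lp ℂ ∞ μ) : mulOp μ f (oneL2 μ) =ᵐ[μ] f := by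
  filter_upwards [coeFn_mulOp f (oneL2 μ), coeFn_oneL2 (μ := μ)] with x h1 h2
  rw [h1, h2, mul_one]

/-- The bounded functions are dense in `L²(X, μ)`. -/
theorem denseRange_mulOp_oneL2 : DenseRange fun f : Lp ℂ ∞ μ => mulOp μ f (oneL2 μ) := by
  let Φ : Lp ℂ ∞ μ →+ Lp ℂ 2 μ :=
    { toFun := fun f => mulOp μ f (oneL2 μ)
      map_zero' := by simp [mulOp]
      map_add' := fun f g => by simp [mulOp] }
  intro v
  change v ∈ closure (Set.range Φ)
  rw [← AddMonoidHom.coe_range, ← AddSubgroup.topologicalClosure_coe]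
  refine Lp.induction (p := 2) (by simp)
    (motive := fun v => v ∈ (AddMonoidHom.range Φ).topologicalClosure) ?_
    (fun f g _ _ _ h1 h2 => add_mem h1 h2) (AddSubgroup.isClosed_topologicalClosure _) v
  intro c s hs hμ
  refine AddSubgroup.le_topologicalClosure _ ⟨indicatorConstLp ∞ hs hμ.ne c, Lp.ext ?_⟩
  rw [Lp.simpleFunc.coe_indicatorConst]
  exact (coeFn_mulOp_oneL2 _).trans (indicatorConstLp_coeFn.trans indicatorConstLp_coeFn.symm)

/-- `L^∞(X, μ)` is maximal abelian in the bounded operators on `L²(X, μ)`. -/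
theorem exists_eq_mulOp_of_commute {B : Lp ℂ 2 μ →L[ℂ] Lp ℂ 2 μ}
    (hB : ∀ f v, B (mulOp μ f v) = mulOp μ f (B v)) : ∃ f : Lp ℂ ∞ μ, B = mulOp μ f := by
  set b := B (oneL2 μ) with hb
  -- comparing integrals over an arbitrary set `s` bounds `b = B 1` by the norm of `B`
  have hbound : ∀ᵐ x ∂μ, ‖b x‖ₑ ^ 2 ≤ ‖B‖ₑ ^ 2 := by
    have hm := Lp.stronglyMeasurable b
    refine ae_le_of_forall_setLIntegral_le_of_sigmaFinite (hm.enorm.pow_const 2)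
      fun s hs _ => ?_
    let g : Lp ℂ ∞ μ := indicatorConstLp ∞ hs (measure_ne_top μ s) 1
    have h1 : ‖B (mulOp μ g (oneL2 μ))‖ₑ ^ 2 ≤ ‖B‖ₑ ^ 2 * ‖mulOp μ g (oneL2 μ)‖ₑ ^ 2 := by
      rw [← mul_pow]
      gcongr
      exact B.le_opENorm _
    have hg := (indicatorConstLp_coeFn (p := ∞) (hs := hs) (hμs := measure_ne_top μ s)
      (c := (1 : ℂ)))
    rw [hB, ← hb, enorm_sq_eq_lintegral, enorm_sq_eq_lintegral] at h1
    have e2 : ∫⁻ x, ‖mulOp μ g b x‖ₑ ^ 2 ∂μ = ∫⁻ x in s, ‖b x‖ₑ ^ 2 ∂μ := by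
      rw [← lintegral_indicator hs]
      refine lintegral_congr_ae ?_
      filter_upwards [coeFn_mulOp g b, hg] with x h2 h3
      rw [h2, h3]
      by_cases hx : x ∈ s <;> simp [hx]
    have e3 : ∫⁻ x, ‖mulOp μ g (oneL2 μ) x‖ₑ ^ 2 ∂μ = μ s := by
      rw [← lintegral_indicator_one hs]
      refine lintegral_congr_ae ?_
      filter_upwards [coeFn_mulOp_oneL2 g, hg] with x h2 h3
      rw [h2, h3]
      by_cases hx : x ∈ s <;> simp [hx]
    rw [e2, e3] at h1
    simpa using h1
  have hmem : MemLp b ∞ μ := by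
    refine memLp_top_of_bound (Lp.aestronglyMeasurable b) ‖B‖ ?_
    filter_upwards [hbound] with x hx
    have h1 : ‖b x‖ₑ ≤ ‖B‖ₑ := (ENNReal.pow_le_pow_left_iff two_ne_zero).1 hx
    exact enorm_le_iff_norm_le.1 h1
  refine ⟨hmem.toLp b, ContinuousLinearMap.ext fun v => ?_⟩
  refine denseRange_mulOp_oneL2.induction_on (p := fun v => B v = mulOp μ (hmem.toLp b) v) v
    (isClosed_eq B.continuous (mulOp μ _).continuous) fun f => ?_
  rw [hB, mulOp_comm]
  congr 1
  refine Lp.ext ?_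
  filter_upwards [coeFn_mulOp_oneL2 (hmem.toLp b), hmem.coeFn_toLp] with x h1 h2
  rw [h1, h2]

end Multiplication

/-! ### Translation on `L^p` -/

section Koopman

variable {Γ : Type*} [Group Γ] {X : Type*} [MeasurableSpace X] [MulAction Γ X]
  [MeasurableConstSMul Γ X] (μ : Measure X) [SMulInvariantMeasure Γ X μ]

/-- The translate `x ↦ f (t x)` of an element of `L^p(X, μ)`. -/
noncomputable def lpTranslate {p : ℝ≥0∞} (t : Γ) (f : Lp ℂ p μ) : Lp ℂ p μ :=
  Lp.compMeasurePreserving (fun x : X => t • x) (measurePreserving_smul t μ) f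

variable {μ}

theorem coeFn_lpTranslate {p : ℝ≥0∞} (t : Γ) (f : Lp ℂ p μ) :
    lpTranslate μ t f =ᵐ[μ] fun x => f (t • x) :=
  Lp.coeFn_compMeasurePreserving f (measurePreserving_smul t μ)

theorem ae_smul (t : Γ) {P : X → Prop} (h : ∀ᵐ x ∂μ, P x) : ∀ᵐ x ∂μ, P (t • x) :=
  (measurePreserving_smul t μ).quasiMeasurePreserving.ae h

theorem lpTranslate_add {p : ℝ≥0∞} (t : Γ) (f g : Lp ℂ p μ) :
    lpTranslate μ t (f + g) = lpTranslate μ t f + lpTranslate μ t g :=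
  map_add _ f g

theorem lpTranslate_sub {p : ℝ≥0∞} (t : Γ) (f g : Lp ℂ p μ) :
    lpTranslate μ t (f - g) = lpTranslate μ t f - lpTranslate μ t g :=
  map_sub _ f g

theorem lpTranslate_lpTranslate {p : ℝ≥0∞} (s t : Γ) (f : Lp ℂ p μ) :
    lpTranslate μ s (lpTranslate μ t f) = lpTranslate μ (t * s) f := by
  refine Lp.ext ?_
  filter_upwards [coeFn_lpTranslate s (lpTranslate μ t f), ae_smul s (coeFn_lpTranslate t f),
    coeFn_lpTranslate (t * s) f] with x h1 h2 h3
  rw [h1, h2, h3, mul_smul]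

theorem lpTranslate_one {p : ℝ≥0∞} (f : Lp ℂ p μ) : lpTranslate μ (1 : Γ) f = f := by
  refine Lp.ext ?_
  filter_upwards [coeFn_lpTranslate (1 : Γ) f] with x h1
  rw [h1, one_smul]

theorem norm_lpTranslate {p : ℝ≥0∞} (t : Γ) (f : Lp ℂ p μ) : ‖lpTranslate μ t f‖ = ‖f‖ :=
  Lp.norm_compMeasurePreserving f (measurePreserving_smul t μ)

theorem lpTranslate_mulOp (t : Γ) (f : Lp ℂ ∞ μ) (v : Lp ℂ 2 μ) :
    lpTranslate μ t (mulOp μ f v) = mulOp μ (lpTranslate μ t f) (lpTranslate μ t v) := by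
  refine Lp.ext ?_
  filter_upwards [coeFn_lpTranslate t (mulOp μ f v), ae_smul t (coeFn_mulOp f v),
    coeFn_mulOp (lpTranslate μ t f) (lpTranslate μ t v), coeFn_lpTranslate t f,
    coeFn_lpTranslate t v] with x h1 h2 h3 h4 h5
  rw [h1, h2, h3, h4, h5]

theorem lpTranslate_star {p : ℝ≥0∞} (t : Γ) (f : Lp ℂ p μ) :
    lpTranslate μ t (star f) = star (lpTranslate μ t f) := by
  refine Lp.ext ?_
  filter_upwards [coeFn_lpTranslate t (star f), ae_smul t (Lp.coeFn_star f),
    Lp.coeFn_star (lpTranslate μ t f), coeFn_lpTranslate t f] with x h1 h2 h3 h4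
  rw [h1, h2, h3, Pi.star_apply, Pi.star_apply, h4]

theorem lpTranslate_oneL2 [IsProbabilityMeasure μ] (t : Γ) :
    lpTranslate μ t (oneL2 μ) = oneL2 μ := by
  refine Lp.ext ?_
  filter_upwards [coeFn_lpTranslate t (oneL2 μ), ae_smul t (coeFn_oneL2 (μ := μ)),
    coeFn_oneL2 (μ := μ)] with x h1 h2 h3
  rw [h1, h2, h3]

end Koopman

/-! ### Generators of the crossed product and of its commutant -/

section ConstMul

variable {Γ X : Type*} [MeasurableSpace X] {μ : Measure X}

variable (Γ) in
/-- The operator `1 ⊗ f` on `ℓ²(Γ, L²(X, μ))`, multiplying every coordinate by `f ∈ L^∞(X, μ)`. -/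
noncomputable def constMulOp (f : Lp ℂ ∞ μ) : EllTwo Γ (Lp ℂ 2 μ) →L[ℂ] EllTwo Γ (Lp ℂ 2 μ) :=
  diagonalOp ⟨fun _ : Γ => mulOp μ f, memℓp_infty ⟨‖mulOp μ f‖, by rintro _ ⟨t, rfl⟩; rfl⟩⟩

theorem constMulOp_apply (f : Lp ℂ ∞ μ) (ξ : EllTwo Γ (Lp ℂ 2 μ)) (t : Γ) :
    constMulOp Γ f ξ t = mulOp μ f (ξ t) := rfl

theorem constMulOp_pointVector (f : Lp ℂ ∞ μ) (t : Γ) (v : Lp ℂ 2 μ) :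
    constMulOp Γ f (pointVector t v) = pointVector t (mulOp μ f v) := by
  refine lp.ext (funext fun r => ?_)
  rw [constMulOp_apply]
  by_cases h : r = t
  · subst h
    rw [pointVector_apply_self, pointVector_apply_self]
  · rw [pointVector_apply_of_ne h, pointVector_apply_of_ne h, map_zero]

end ConstMul

section CrossedProduct

variable {Γ : Type*} [Group Γ] {X : Type*} [MeasurableSpace X] [MulAction Γ X]
  [MeasurableConstSMul Γ X] {μ : Measure X} [SMulInvariantMeasure Γ X μ]

theorem vnCoeffOp_apply (f : Lp ℂ ∞ μ) (ξ : EllTwo Γ (Lp ℂ 2 μ)) (t : Γ) :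
    vnCoeffOp Γ μ f ξ t = mulOp μ (lpTranslate μ t f) (ξ t) := rfl

theorem norm_vnCoeffOp_le (f : Lp ℂ ∞ μ) : ‖vnCoeffOp Γ μ f‖ ≤ ‖f‖ := by
  refine (norm_diagonalOp_le _).trans (lp.norm_le_of_forall_le (norm_nonneg f) fun t => ?_)
  exact (norm_mulOp_le _).trans (norm_lpTranslate t f).le

theorem star_vnCoeffOp (f : Lp ℂ ∞ μ) : star (vnCoeffOp Γ μ f) = vnCoeffOp Γ μ (star f) :=
  star_diagonalOp _ _ fun t => by
    change mulOp μ (lpTranslate μ t (star f)) = star (mulOp μ (lpTranslate μ t f))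
    rw [star_mulOp, lpTranslate_star]

theorem vnCoeffOp_add (f g : Lp ℂ ∞ μ) :
    vnCoeffOp Γ μ (f + g) = vnCoeffOp Γ μ f + vnCoeffOp Γ μ g := by
  refine ContinuousLinearMap.ext fun ξ => lp.ext (funext fun t => ?_)
  rw [vnCoeffOp_apply, lpTranslate_add]
  change _ = mulOp μ (lpTranslate μ t f) (ξ t) + mulOp μ (lpTranslate μ t g) (ξ t)
  simp [mulOp]

theorem vnCoeffOp_pointVector (f : Lp ℂ ∞ μ) (t : Γ) (v : Lp ℂ 2 μ) :
    vnCoeffOp Γ μ f (pointVector t v) = pointVector t (mulOp μ (lpTranslate μ t f) v) := by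
  refine lp.ext (funext fun r => ?_)
  rw [vnCoeffOp_apply]
  by_cases h : r = t
  · subst h
    rw [pointVector_apply_self, pointVector_apply_self]
  · rw [pointVector_apply_of_ne h, pointVector_apply_of_ne h, map_zero]

/-- The covariance relation `λ_s σ(f) = σ(s · f) λ_s`. -/
theorem leftTranslation_mul_vnCoeffOp (s : Γ) (f : Lp ℂ ∞ μ) :
    leftTranslation s * vnCoeffOp Γ μ f =
      vnCoeffOp Γ μ (lpTranslate μ s⁻¹ f) * leftTranslation s := by
  refine ContinuousLinearMap.ext fun ξ => lp.ext (funext fun t => ?_)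
  change vnCoeffOp Γ μ f ξ (s⁻¹ * t) =
    vnCoeffOp Γ μ (lpTranslate μ s⁻¹ f) (leftTranslation s ξ) t
  rw [vnCoeffOp_apply, vnCoeffOp_apply, lpTranslate_lpTranslate, leftTranslation_apply]

theorem vnCoeffOp_mem_crossedProduct (f : Lp ℂ ∞ μ) :
    vnCoeffOp Γ μ f ∈ vonNeumannCrossedProduct Γ μ :=
  subset_vonNeumannGenerated _ (Or.inl ⟨f, rfl⟩)

/-! ### The commutant of the crossed product and the canonical vector -/

theorem memlp_rightTwist (s : Γ) (ξ : EllTwo Γ (Lp ℂ 2 μ)) :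
    Memℓp (fun t : Γ => lpTranslate μ s⁻¹ (ξ (t * s))) 2 := by
  have h := lp.memℓp ξ
  rw [memℓp_gen_iff (by simp)] at h ⊢
  simp only [norm_lpTranslate]
  exact (Equiv.mulRight s).summable_iff.2 h

variable (μ) in
/-- The twisted right translation `(ρ_s ξ)(t) = s · ξ(t s)`, an isometry commuting with the crossed
product. -/
noncomputable def rightTwist (s : Γ) : EllTwo Γ (Lp ℂ 2 μ) →ₗᵢ[ℂ] EllTwo Γ (Lp ℂ 2 μ) where
  toFun ξ := ⟨_, memlp_rightTwist s ξ⟩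
  map_add' ξ η := lp.ext (funext fun t => lpTranslate_add s⁻¹ (ξ (t * s)) (η (t * s)))
  map_smul' c ξ := lp.ext (funext fun t =>
    map_smul (Lp.compMeasurePreservingₗᵢ ℂ _ (measurePreserving_smul s⁻¹ μ)) c (ξ (t * s)))
  norm_map' ξ := by
    have h := (Equiv.mulRight s).hasSum_iff.2 (hasSum_norm_sq ξ)
    have h2 := hasSum_norm_sq (⟨_, memlp_rightTwist s ξ⟩ : EllTwo Γ (Lp ℂ 2 μ))
    have e : (fun t => ‖(⟨_, memlp_rightTwist s ξ⟩ : EllTwo Γ (Lp ℂ 2 μ)) t‖ ^ 2) =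
        (fun t => ‖ξ t‖ ^ 2) ∘ Equiv.mulRight s :=
      funext fun t => congrArg (· ^ 2) (norm_lpTranslate s⁻¹ (ξ (t * s)))
    rw [e] at h2
    exact (pow_left_inj₀ (norm_nonneg _) (norm_nonneg _) two_ne_zero).1 (h2.unique h)

theorem rightTwist_apply (s : Γ) (ξ : EllTwo Γ (Lp ℂ 2 μ)) (t : Γ) :
    rightTwist μ s ξ t = lpTranslate μ s⁻¹ (ξ (t * s)) := rfl

theorem rightTwist_pointVector (s t : Γ) (v : Lp ℂ 2 μ) :
    rightTwist μ s (pointVector t v) = pointVector (t * s⁻¹) (lpTranslate μ s⁻¹ v) := by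
  refine lp.ext (funext fun r => ?_)
  rw [rightTwist_apply]
  by_cases h : r = t * s⁻¹
  · subst h
    rw [inv_mul_cancel_right, pointVector_apply_self, pointVector_apply_self]
  · rw [pointVector_apply_of_ne h, pointVector_apply_of_ne fun h' => h (by simp [← h'])]
    exact map_zero _

/-- An operator commuting with all `λ_s` and all `σ(f)` commutes with the crossed product. -/
theorem commute_of_mem_crossedProduct {T R : EllTwo Γ (Lp ℂ 2 μ) →L[ℂ] EllTwo Γ (Lp ℂ 2 μ)}
    (hT : T ∈ vonNeumannCrossedProduct Γ μ)
    (hl : ∀ s : Γ, leftTranslation s * R = R * leftTranslation s)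
    (hc : ∀ f, vnCoeffOp Γ μ f * R = R * vnCoeffOp Γ μ f) : R * T = T * R := by
  refine mem_vonNeumannGenerated_iff.1 hT R ?_
  rintro _ (⟨f, rfl⟩ | ⟨s, rfl⟩)
  · exact ⟨hc f, by rw [star_vnCoeffOp]; exact hc _⟩
  · exact ⟨hl s, by dsimp only; rw [star_leftTranslation]; exact hl _⟩

theorem apply_rightTwist {T : EllTwo Γ (Lp ℂ 2 μ) →L[ℂ] EllTwo Γ (Lp ℂ 2 μ)}
    (hT : T ∈ vonNeumannCrossedProduct Γ μ) (s : Γ) (ξ : EllTwo Γ (Lp ℂ 2 μ)) :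
    T (rightTwist μ s ξ) = rightTwist μ s (T ξ) := by
  have h := commute_of_mem_crossedProduct (R := (rightTwist μ s).toContinuousLinearMap) hT
    (fun r => ContinuousLinearMap.ext fun ξ => lp.ext (funext fun t => by
      change lpTranslate μ s⁻¹ (ξ (r⁻¹ * t * s)) = lpTranslate μ s⁻¹ (ξ (r⁻¹ * (t * s)))
      rw [mul_assoc]))
    (fun f => ContinuousLinearMap.ext fun ξ => lp.ext (funext fun t => by
      change mulOp μ (lpTranslate μ t f) (lpTranslate μ s⁻¹ (ξ (t * s))) =
        lpTranslate μ s⁻¹ (mulOp μ (lpTranslate μ (t * s) f) (ξ (t * s)))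
      rw [lpTranslate_mulOp, lpTranslate_lpTranslate, mul_inv_cancel_right]))
  exact (congrArg (fun S : EllTwo Γ (Lp ℂ 2 μ) →L[ℂ] EllTwo Γ (Lp ℂ 2 μ) => S ξ) h).symm

theorem apply_constMulOp {T : EllTwo Γ (Lp ℂ 2 μ) →L[ℂ] EllTwo Γ (Lp ℂ 2 μ)}
    (hT : T ∈ vonNeumannCrossedProduct Γ μ) (f : Lp ℂ ∞ μ) (ξ : EllTwo Γ (Lp ℂ 2 μ)) :
    T (constMulOp Γ f ξ) = constMulOp Γ f (T ξ) := by
  have h := commute_of_mem_crossedProduct (R := constMulOp Γ f) hT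
    (fun r => ContinuousLinearMap.ext fun ξ => lp.ext (funext fun t => rfl))
    (fun g => ContinuousLinearMap.ext fun ξ => lp.ext (funext fun t => mulOp_comm _ _ _))
  exact (congrArg (fun S : EllTwo Γ (Lp ℂ 2 μ) →L[ℂ] EllTwo Γ (Lp ℂ 2 μ) => S ξ) h).symm

/-- The matrix entries of an operator in terms of the diagonal parts of its products with
translations, its Fourier coefficients. -/
theorem apply_pointVector_of_diagonalPart_eq
    {T : EllTwo Γ (Lp ℂ 2 μ) →L[ℂ] EllTwo Γ (Lp ℂ 2 μ)} {F : Γ → Lp ℂ ∞ μ}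
    (hF : ∀ γ, diagonalPart (T * leftTranslation γ⁻¹) = vnCoeffOp Γ μ (F γ)) (r t : Γ)
    (v : Lp ℂ 2 μ) :
    T (pointVector r v) t = mulOp μ (lpTranslate μ t (F (t * r⁻¹))) v := by
  have h := congrArg (fun S : EllTwo Γ (Lp ℂ 2 μ) →L[ℂ] EllTwo Γ (Lp ℂ 2 μ) =>
    S (pointVector t v) t) (hF (t * r⁻¹))
  dsimp only at h
  rw [diagonalPart_pointVector, vnCoeffOp_pointVector, pointVector_apply_self,
    pointVector_apply_self] at h
  rw [← h]
  change _ = T (leftTranslation (t * r⁻¹)⁻¹ (pointVector t v)) t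
  rw [leftTranslation_pointVector]
  group

variable [IsProbabilityMeasure μ]

/-- The canonical vector `δ_1 ⊗ 1`, implementing the trace of the crossed product, is cyclic for the
commutant. Hence convergence of bounded sequences can be tested on it. -/
theorem tendsto_apply_of_tendsto_canonicalVector
    {x : ℕ → EllTwo Γ (Lp ℂ 2 μ) →L[ℂ] EllTwo Γ (Lp ℂ 2 μ)}
    {y : EllTwo Γ (Lp ℂ 2 μ) →L[ℂ] EllTwo Γ (Lp ℂ 2 μ)}
    (hx : ∀ n, x n ∈ vonNeumannCrossedProduct Γ μ) (hy : y ∈ vonNeumannCrossedProduct Γ μ)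
    {C : ℝ} (hC : ∀ n, ‖x n‖ ≤ C)
    (h : Tendsto (fun n => x n (pointVector 1 (oneL2 μ))) atTop
      (𝓝 (y (pointVector 1 (oneL2 μ))))) (ξ : EllTwo Γ (Lp ℂ 2 μ)) :
    Tendsto (fun n => x n ξ) atTop (𝓝 (y ξ)) := by
  have hcl := isClosed_setOf_tendsto_apply (l := atTop) hC y
  have h1 : ∀ (r : Γ) (f : Lp ℂ ∞ μ), Tendsto (fun n => x n (pointVector r (mulOp μ f (oneL2 μ))))
      atTop (𝓝 (y (pointVector r (mulOp μ f (oneL2 μ))))) := by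
    intro r f
    have e : pointVector r (mulOp μ f (oneL2 μ)) =
        constMulOp Γ f (rightTwist μ r⁻¹ (pointVector 1 (oneL2 μ))) := by
      rw [rightTwist_pointVector, lpTranslate_oneL2, constMulOp_pointVector, inv_inv, one_mul]
    simp only [e, apply_constMulOp (hx _), apply_rightTwist (hx _), apply_constMulOp hy,
      apply_rightTwist hy]
    exact ((constMulOp Γ f).continuous.tendsto _).comp
      (((rightTwist μ r⁻¹).continuous.tendsto _).comp h)
  have h2 : ∀ (r : Γ) (v : Lp ℂ 2 μ), Tendsto (fun n => x n (pointVector r v)) atTop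
      (𝓝 (y (pointVector r v))) := fun r v =>
    denseRange_mulOp_oneL2.induction_on
      (p := fun v => Tendsto (fun n => x n (pointVector r v)) atTop (𝓝 (y (pointVector r v)))) v
      (hcl.preimage (continuous_pointVector r)) (h1 r)
  refine hcl.mem_of_tendsto (hasSum_pointVector ξ) (Eventually.of_forall fun F => ?_)
  change Tendsto (fun n => x n (∑ t ∈ F, pointVector t (ξ t))) atTop
    (𝓝 (y (∑ t ∈ F, pointVector t (ξ t))))
  simp only [map_sum]
  exact tendsto_finsetSum _ fun t _ => h2 t (ξ t)

/-! ### Fourier coefficients -/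

/-- The diagonal part of an element of the crossed product is `σ(f)` for some `f ∈ L^∞(X, μ)`. -/
theorem exists_diagonalPart_eq_vnCoeffOp {T : EllTwo Γ (Lp ℂ 2 μ) →L[ℂ] EllTwo Γ (Lp ℂ 2 μ)}
    (hT : T ∈ vonNeumannCrossedProduct Γ μ) :
    ∃ f : Lp ℂ ∞ μ, diagonalPart T = vnCoeffOp Γ μ f := by
  obtain ⟨f, hf⟩ := exists_eq_mulOp_of_commute (B := diagonalBlock T 1) fun f v => by
    change T (pointVector 1 (mulOp μ f v)) 1 = mulOp μ f (T (pointVector 1 v) 1)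
    rw [← constMulOp_pointVector, apply_constMulOp hT, constMulOp_apply]
  refine ⟨f, ContinuousLinearMap.ext fun ξ => lp.ext (funext fun t => ?_)⟩
  change T (pointVector t (ξ t)) t = mulOp μ (lpTranslate μ t f) (ξ t)
  have h1 : pointVector t (ξ t) =
      rightTwist μ t⁻¹ (pointVector 1 (lpTranslate μ t⁻¹ (ξ t))) := by
    rw [rightTwist_pointVector, lpTranslate_lpTranslate, inv_inv, one_mul, inv_mul_cancel,
      lpTranslate_one]
  have h2 : T (pointVector 1 (lpTranslate μ t⁻¹ (ξ t))) 1 =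
      mulOp μ f (lpTranslate μ t⁻¹ (ξ t)) :=
    congrArg (fun S : Lp ℂ 2 μ →L[ℂ] Lp ℂ 2 μ => S (lpTranslate μ t⁻¹ (ξ t))) hf
  rw [h1, apply_rightTwist hT, rightTwist_apply, mul_inv_cancel, h2, lpTranslate_mulOp, inv_inv,
    lpTranslate_lpTranslate, inv_mul_cancel, lpTranslate_one]

end CrossedProduct

/-! ### Invariance under the conditional expectation -/

section MeasureRigid

variable {Γ : Type*} [Group Γ] {X : Type*} [MeasurableSpace X] [MulAction Γ X]
  [MeasurableConstSMul Γ X] {μ : Measure X} [SMulInvariantMeasure Γ X μ]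

/-- Along a rigid net, the translations converge strongly to the identity of `L²(X, μ)`. -/
theorem IsMeasureRigidNet.tendsto_lpTranslate {ι : Type*} {l : Filter ι} {s : ι → Γ}
    (hs : IsMeasureRigidNet μ l s) (v : Lp ℂ 2 μ) :
    Tendsto (fun i => lpTranslate μ (s i) v) l (𝓝 v) := by
  let U : ι → Lp ℂ 2 μ →L[ℂ] Lp ℂ 2 μ := fun i =>
    (Lp.compMeasurePreservingₗᵢ ℂ (fun x : X => s i • x)
      (measurePreserving_smul (s i) μ)).toContinuousLinearMap
  have hU : ∀ i v, U i v = lpTranslate μ (s i) v := fun _ _ => rfl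
  have hcl := isClosed_setOf_tendsto_apply (l := l) (x := U) (C := 1)
    (fun i => LinearIsometry.norm_toContinuousLinearMap_le _) (ContinuousLinearMap.id ℂ _)
  simp only [hU, ContinuousLinearMap.id_apply] at hcl
  refine Lp.induction (p := 2) (by simp)
    (motive := fun v => Tendsto (fun i => lpTranslate μ (s i) v) l (𝓝 v)) ?_
    (fun f g hf hg _ h1 h2 => by simpa only [lpTranslate_add] using h1.add h2) hcl v
  intro c A hA hμA
  rw [Lp.simpleFunc.coe_indicatorConst]
  have hpre : ∀ t : Γ, MeasurableSet ((fun x : X => t • x) ⁻¹' A) := fun t =>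
    measurable_const_smul t hA
  have hμ : ∀ t : Γ, μ ((fun x : X => t • x) ⁻¹' A) ≠ ∞ := fun t => by
    rw [(measurePreserving_smul t μ).measure_preimage hA.nullMeasurableSet]
    exact hμA.ne
  have e : ∀ t : Γ, lpTranslate μ t (indicatorConstLp 2 hA hμA.ne c) =
      indicatorConstLp 2 (hpre t) (hμ t) c := fun t => by
    refine Lp.ext ?_
    filter_upwards [coeFn_lpTranslate t (indicatorConstLp 2 hA hμA.ne c),
      ae_smul t (indicatorConstLp_coeFn (p := 2) (hs := hA) (hμs := hμA.ne) (c := c)),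
      indicatorConstLp_coeFn (p := 2) (hs := hpre t) (hμs := hμ t) (c := c)] with x h1 h2 h3
    rw [h1, h2, h3]
    rfl
  simp only [e]
  refine tendsto_indicatorConstLp_set (by simp) ?_
  refine (hs.tendsto A hA).congr fun i => ?_
  have hpreimage : (fun x : X => s i • x) ⁻¹' ((s i • A) ∆ A) =
      ((fun x : X => s i • x) ⁻¹' A) ∆ A := by
    rw [Set.preimage_symmDiff, Set.preimage_smul, Set.preimage_smul, inv_smul_smul, symmDiff_comm]
  rw [← hpreimage, (measurePreserving_smul (s i) μ).measure_preimage]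
  exact ((hA.const_smul (s i)).symmDiff hA).nullMeasurableSet

theorem IsMeasureRigidNet.eventually_norm_lpTranslate_sub_le {ι : Type*} {l : Filter ι} {s : ι → Γ}
    (hs : IsMeasureRigidNet μ l s) (h : Γ) (v : Lp ℂ 2 μ) {δ : ℝ} (hδ : 0 < δ) :
    ∀ᶠ i in l, ‖lpTranslate μ (h⁻¹ * s i * h) v - v‖ ≤ δ := by
  filter_upwards [Metric.tendsto_nhds.1 (hs.tendsto_lpTranslate (lpTranslate μ h⁻¹ v)) δ hδ]
    with i hi
  have e : lpTranslate μ (h⁻¹ * s i * h) v - v =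
      lpTranslate μ h (lpTranslate μ (s i) (lpTranslate μ h⁻¹ v) - lpTranslate μ h⁻¹ v) := by
    rw [lpTranslate_sub, lpTranslate_lpTranslate, lpTranslate_lpTranslate,
      lpTranslate_lpTranslate, inv_mul_cancel, lpTranslate_one, mul_assoc]
  rw [e, norm_lpTranslate, ← dist_eq_norm]
  exact hi.le

end MeasureRigid

section Expectation

variable {Γ : Type*} [Group Γ] {X : Type*} [MeasurableSpace X] [MulAction Γ X]
  [MeasurableConstSMul Γ X] {μ : Measure X} [SMulInvariantMeasure Γ X μ]

variable (μ) in
/-- The unitary `ξ ↦ λ_g⁻¹ ρ_g⁻¹ ξ` implementing conjugation by `λ_g` on the canonical vector. -/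
noncomputable def conjVector (g : Γ) (ξ : EllTwo Γ (Lp ℂ 2 μ)) : EllTwo Γ (Lp ℂ 2 μ) :=
  leftTranslation g⁻¹ (rightTwist μ g⁻¹ ξ)

theorem norm_conjVector (g : Γ) (ξ : EllTwo Γ (Lp ℂ 2 μ)) : ‖conjVector μ g ξ‖ = ‖ξ‖ := by
  rw [conjVector, norm_leftTranslation_apply, LinearIsometry.norm_map]

theorem conjVector_sub (g : Γ) (ξ η : EllTwo Γ (Lp ℂ 2 μ)) :
    conjVector μ g (ξ - η) = conjVector μ g ξ - conjVector μ g η := by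
  rw [conjVector, map_sub, map_sub, conjVector, conjVector]

theorem conjVector_sum {α : Type*} (g : Γ) (F : Finset α) (ξ : α → EllTwo Γ (Lp ℂ 2 μ)) :
    conjVector μ g (∑ a ∈ F, ξ a) = ∑ a ∈ F, conjVector μ g (ξ a) := by
  simp only [conjVector, map_sum]

theorem conjVector_pointVector (g γ : Γ) (v : Lp ℂ 2 μ) :
    conjVector μ g (pointVector γ v) = pointVector (g⁻¹ * γ * g) (lpTranslate μ g v) := by
  rw [conjVector, rightTwist_pointVector, leftTranslation_pointVector, inv_inv, mul_assoc]

/-- If the `g k` almost fix `v`, then averaging `conjVector` over the `g k` moves `δ_γ ⊗ v` to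
almost `0` when the conjugates of `γ` average to a small operator, and hardly moves it when
`γ = 1`. -/
theorem norm_sum_conjVector_pointVector_sub_le [DecidableEq Γ] {κ : Type*} [Fintype κ] {w : κ → ℝ}
    (hw : ∀ k, 0 ≤ w k) (hw1 : ∑ k, w k = 1) (g : κ → Γ) (γ : Γ) (v : Lp ℂ 2 μ) {δ : ℝ}
    (hδ : ∀ k, ‖lpTranslate μ (g k) v - v‖ ≤ δ)
    (hγ : γ ≠ 1 → ‖∑ k, (w k : ℂ) • (leftTranslation ((g k)⁻¹ * γ * g k) :
      EllTwo Γ (Lp ℂ 2 μ) →L[ℂ] EllTwo Γ (Lp ℂ 2 μ))‖ ≤ δ) :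
    ‖∑ k, (w k : ℂ) • conjVector μ (g k) (pointVector γ v) -
      if γ = 1 then pointVector 1 v else 0‖ ≤ δ * (1 + ‖v‖) := by
  have h1 : ‖∑ k, (w k : ℂ) • pointVector ((g k)⁻¹ * γ * g k) (lpTranslate μ (g k) v - v)‖ ≤ δ :=
    norm_sum_smul_le hw hw1 fun k => by
      rw [norm_pointVector]
      exact hδ k
  have hδ0 : 0 ≤ δ := (norm_nonneg _).trans h1
  have h2 : ‖∑ k, (w k : ℂ) • pointVector ((g k)⁻¹ * γ * g k) v -
      if γ = 1 then pointVector 1 v else 0‖ ≤ δ * ‖v‖ := by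
    split_ifs with h
    · subst h
      simp only [mul_one, inv_mul_cancel, ← Finset.sum_smul]
      rw [← Complex.ofReal_sum, hw1, Complex.ofReal_one, one_smul, sub_self, norm_zero]
      positivity
    · have e : ∑ k, (w k : ℂ) • pointVector ((g k)⁻¹ * γ * g k) v =
          (∑ k, (w k : ℂ) • (leftTranslation ((g k)⁻¹ * γ * g k) :
            EllTwo Γ (Lp ℂ 2 μ) →L[ℂ] EllTwo Γ (Lp ℂ 2 μ))) (pointVector 1 v) := by
        rw [sum_apply]
        refine Finset.sum_congr rfl fun k _ => ?_
        rw [smul_apply, leftTranslation_pointVector, mul_one]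
      rw [sub_zero, e]
      refine (ContinuousLinearMap.le_of_opNorm_le _ (hγ h) _).trans ?_
      rw [norm_pointVector]
  have e : ∑ k, (w k : ℂ) • conjVector μ (g k) (pointVector γ v) -
      (if γ = 1 then pointVector 1 v else 0) =
      ∑ k, (w k : ℂ) • pointVector ((g k)⁻¹ * γ * g k) (lpTranslate μ (g k) v - v) +
      (∑ k, (w k : ℂ) • pointVector ((g k)⁻¹ * γ * g k) v -
        if γ = 1 then pointVector 1 v else 0) := by
    rw [← add_sub_assoc, ← Finset.sum_add_distrib]
    congr 1
    refine Finset.sum_congr rfl fun k _ => ?_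
    rw [conjVector_pointVector, pointVector_sub, smul_sub, sub_add_cancel]
  rw [e]
  calc _ ≤ δ + δ * ‖v‖ := (norm_add_le _ _).trans (add_le_add h1 h2)
    _ = δ * (1 + ‖v‖) := by ring

variable [IsProbabilityMeasure μ]

theorem conjAverage_canonicalVector {T : EllTwo Γ (Lp ℂ 2 μ) →L[ℂ] EllTwo Γ (Lp ℂ 2 μ)}
    (hT : T ∈ vonNeumannCrossedProduct Γ μ) {κ : Type*} [Fintype κ] (w : κ → ℝ) (g : κ → Γ) :
    conjAverage w g T (pointVector 1 (oneL2 μ)) =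
      ∑ k, (w k : ℂ) • conjVector μ (g k) (T (pointVector 1 (oneL2 μ))) := by
  rw [conjAverage_apply, sum_apply]
  refine Finset.sum_congr rfl fun k _ => ?_
  rw [smul_apply]
  change _ • leftTranslation (g k)⁻¹ (T (leftTranslation (g k) (pointVector 1 (oneL2 μ)))) = _
  have e : leftTranslation (g k) (pointVector 1 (oneL2 μ)) =
      rightTwist μ (g k)⁻¹ (pointVector 1 (oneL2 μ)) := by
    rw [leftTranslation_pointVector, rightTwist_pointVector, lpTranslate_oneL2, inv_inv, mul_one,
      one_mul]
  rw [e, apply_rightTwist hT, conjVector]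

/-- A net that is rigid on `(X, μ)` and strongly proximal on a topologically free boundary provides
averages of conjugates that converge to the conditional expectation on the canonical vector. -/
theorem exists_conjAverage_near_diagonalPart
    {Z : Type*} [TopologicalSpace Z] [CompactSpace Z] [T2Space Z]
    [MeasurableSpace Z] [BorelSpace Z] [MulAction Γ Z] [ContinuousConstSMul Γ Z]
    (hZ : IsBoundary Γ Z) (hfree : IsTopologicallyFree Γ Z)
    {ι : Type*} {l : Filter ι} [l.NeBot] {s : ι → Γ}
    (hrig : IsMeasureRigidNet μ l s) (hprox : IsStronglyProximalNet Z l s)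
    {T : EllTwo Γ (Lp ℂ 2 μ) →L[ℂ] EllTwo Γ (Lp ℂ 2 μ)}
    (hT : T ∈ vonNeumannCrossedProduct Γ μ) {ε : ℝ} (hε : 0 < ε) :
    ∃ (κ : Type) (_ : Fintype κ) (w : κ → ℝ) (g : κ → Γ), (∀ k, 0 ≤ w k) ∧ ∑ k, w k = 1 ∧
      ‖conjAverage w g T (pointVector 1 (oneL2 μ)) -
        diagonalPart T (pointVector 1 (oneL2 μ))‖ < ε := by
  classical
  set v := T (pointVector 1 (oneL2 μ)) with hv
  obtain ⟨F, hF1, hF⟩ : ∃ F : Finset Γ, 1 ∈ F ∧ ‖v - ∑ γ ∈ F, pointVector γ (v γ)‖ < ε / 2 := by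
    obtain ⟨F, h1, h2⟩ := ((eventually_ge_atTop ({1} : Finset Γ)).and
      (Metric.tendsto_nhds.1 (hasSum_pointVector v) (ε / 2) (by positivity))).exists
    exact ⟨F, h1 (by simp), by rwa [dist_comm, dist_eq_norm] at h2⟩
  obtain ⟨h, hh⟩ := exists_average_conj_small (H := Lp ℂ 2 μ) hZ hfree hprox F
  -- each of the finitely many terms `δ_γ ⊗ v γ` contributes an error of at most `δ * (1 + ‖v γ‖)`
  let C : ℝ := ∑ γ ∈ F, (1 + ‖v γ‖)
  have hC : 0 ≤ C := Finset.sum_nonneg fun γ _ => by positivity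
  let δ : ℝ := ε / (2 * (1 + C))
  have hδ : 0 < δ := by positivity
  have hδC : δ * C < ε / 2 := by
    have : δ * (2 * (1 + C)) = ε := div_mul_cancel₀ _ (by positivity)
    nlinarith
  have hev : ∀ᶠ i in l, ∀ γ ∈ F, ‖lpTranslate μ (h⁻¹ * s i * h) (v γ) - v γ‖ ≤ δ :=
    (Finset.eventually_all _).2 fun γ _ => hrig.eventually_norm_lpTranslate_sub_le h (v γ) hδ
  obtain ⟨κ, hκ, w, j, hw, hw1, hj, hsmall⟩ := hh _ hev δ hδ
  let g : κ → Γ := fun k => h⁻¹ * s (j k) * h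
  refine ⟨κ, hκ, w, g, hw, hw1, ?_⟩
  rw [conjAverage_canonicalVector hT, diagonalPart_pointVector, ← hv]
  have hmain : ‖∑ k, (w k : ℂ) • conjVector μ (g k) (∑ γ ∈ F, pointVector γ (v γ)) -
      pointVector 1 (v 1)‖ ≤ δ * C := by
    have e : ∑ k, (w k : ℂ) • conjVector μ (g k) (∑ γ ∈ F, pointVector γ (v γ)) -
        pointVector 1 (v 1) =
        ∑ γ ∈ F, (∑ k, (w k : ℂ) • conjVector μ (g k) (pointVector γ (v γ)) -
          if γ = 1 then pointVector 1 (v γ) else 0) := by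
      rw [Finset.sum_sub_distrib, Finset.sum_ite_eq', if_pos hF1, Finset.sum_comm]
      simp only [conjVector_sum, Finset.smul_sum]
    rw [e, Finset.mul_sum]
    exact (norm_sum_le _ _).trans (Finset.sum_le_sum fun γ hγ =>
      norm_sum_conjVector_pointVector_sub_le hw hw1 g γ (v γ) (fun k => hj k γ hγ)
        (hsmall γ hγ))
  have hrest : ‖∑ k, (w k : ℂ) • conjVector μ (g k) (v - ∑ γ ∈ F, pointVector γ (v γ))‖ ≤
      ‖v - ∑ γ ∈ F, pointVector γ (v γ)‖ :=
    norm_sum_smul_le hw hw1 fun k => (norm_conjVector _ _).le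
  have e : ∑ k, (w k : ℂ) • conjVector μ (g k) v - pointVector 1 (v 1) =
      ∑ k, (w k : ℂ) • conjVector μ (g k) (v - ∑ γ ∈ F, pointVector γ (v γ)) +
      (∑ k, (w k : ℂ) • conjVector μ (g k) (∑ γ ∈ F, pointVector γ (v γ)) -
        pointVector 1 (v 1)) := by
    rw [← add_sub_assoc, ← Finset.sum_add_distrib]
    congr 1
    refine Finset.sum_congr rfl fun k _ => ?_
    rw [conjVector_sub, smul_sub, sub_add_cancel]
  rw [e]
  have := norm_add_le
    (∑ k, (w k : ℂ) • conjVector μ (g k) (v - ∑ γ ∈ F, pointVector γ (v γ)))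
    (∑ k, (w k : ℂ) • conjVector μ (g k) (∑ γ ∈ F, pointVector γ (v γ)) - pointVector 1 (v 1))
  linarith

/-- Intermediate von Neumann algebras are invariant under the conditional expectation. -/
theorem diagonalPart_mem_of_rigid_of_proximal
    {Z : Type*} [TopologicalSpace Z] [CompactSpace Z] [T2Space Z]
    [MeasurableSpace Z] [BorelSpace Z] [MulAction Γ Z] [ContinuousConstSMul Γ Z]
    (hZ : IsBoundary Γ Z) (hfree : IsTopologicallyFree Γ Z)
    {ι : Type*} {l : Filter ι} [l.NeBot] {s : ι → Γ}
    (hrig : IsMeasureRigidNet μ l s) (hprox : IsStronglyProximalNet Z l s)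
    {A : VonNeumannAlgebra (EllTwo Γ (Lp ℂ 2 μ))} (hA : ∀ s : Γ, leftTranslation s ∈ A)
    (hAM : A ≤ vonNeumannCrossedProduct Γ μ)
    {T : EllTwo Γ (Lp ℂ 2 μ) →L[ℂ] EllTwo Γ (Lp ℂ 2 μ)} (hT : T ∈ A) : diagonalPart T ∈ A := by
  obtain ⟨f, hf⟩ := exists_diagonalPart_eq_vnCoeffOp (hAM hT)
  choose κ hκ w g hw hw1 hlt using fun n : ℕ => exists_conjAverage_near_diagonalPart hZ hfree hrig
    hprox (hAM hT) (Nat.one_div_pos_of_nat (α := ℝ) (n := n))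
  have hmem : ∀ n, conjAverage (w n) (g n) T ∈ A := fun n =>
    conjAverage_mem (A := A.toStarSubalgebra) hA (w n) (g n) hT
  refine VonNeumannAlgebra.mem_of_tendsto hmem fun ξ => ?_
  refine tendsto_apply_of_tendsto_canonicalVector (fun n => hAM (hmem n)) ?_
    (fun n => norm_conjAverage_le (hw n) (hw1 n) (g n) T) ?_ ξ
  · rw [hf]
    exact vnCoeffOp_mem_crossedProduct f
  · rw [tendsto_iff_norm_sub_tendsto_zero]
    exact squeeze_zero (fun n => norm_nonneg _) (fun n => (hlt n).le)
      tendsto_one_div_add_atTop_nhds_zero_nat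

end Expectation

/-! ### Reconstruction from Fourier coefficients -/

section Reconstruction

theorem ext_pointVector {Γ H : Type*} [NormedAddCommGroup H] [InnerProductSpace ℂ H]
    {S T : EllTwo Γ H →L[ℂ] EllTwo Γ H}
    (h : ∀ r v t, S (pointVector r v) t = T (pointVector r v) t) : S = T := by
  refine ContinuousLinearMap.ext fun ξ => ?_
  have e : ∀ r v, S (pointVector r v) = T (pointVector r v) := fun r v => lp.ext (funext (h r v))
  refine ((hasSum_pointVector ξ).mapL S).unique ?_
  simp only [e]
  exact (hasSum_pointVector ξ).mapL T

theorem hasSum_apply_pointVector {Γ H : Type*} [NormedAddCommGroup H] [InnerProductSpace ℂ H]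
    (T : EllTwo Γ H →L[ℂ] EllTwo Γ H) (ξ : EllTwo Γ H) (t : Γ) :
    HasSum (fun u => T (pointVector u (ξ u)) t) (T ξ t) :=
  (hasSum_pointVector ξ).mapL (lp.evalCLM ℂ (fun _ : Γ => H) 2 t ∘L T)

variable {Γ : Type*} [Group Γ] {X : Type*} [MeasurableSpace X] [MulAction Γ X]
  [MeasurableConstSMul Γ X] {μ : Measure X} [SMulInvariantMeasure Γ X μ]

/-- An operator whose Fourier coefficients lie in a von Neumann algebra `B` containing all `λ_s`
belongs to `B`. Although the Fourier series need not converge strongly, the matrix entries of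
`R T` and `T R`, for `R` in the commutant of `B`, are sums over `Γ` that agree term by term after
the substitution `u ↦ r u⁻¹ t`. -/
theorem mem_of_forall_coeff_mem {B : VonNeumannAlgebra (EllTwo Γ (Lp ℂ 2 μ))}
    (hB : ∀ s : Γ, leftTranslation s ∈ B)
    {T : EllTwo Γ (Lp ℂ 2 μ) →L[ℂ] EllTwo Γ (Lp ℂ 2 μ)} {F : Γ → Lp ℂ ∞ μ}
    (hF : ∀ γ, diagonalPart (T * leftTranslation γ⁻¹) = vnCoeffOp Γ μ (F γ))
    (hFB : ∀ γ, vnCoeffOp Γ μ (F γ) ∈ B) : T ∈ B := by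
  refine VonNeumannAlgebra.mem_of_forall_commute fun R hR => ext_pointVector fun r v t => ?_
  have hRσ : ∀ γ ξ, R (vnCoeffOp Γ μ (F γ) ξ) = vnCoeffOp Γ μ (F γ) (R ξ) := fun γ ξ =>
    (congrArg (fun S : EllTwo Γ (Lp ℂ 2 μ) →L[ℂ] EllTwo Γ (Lp ℂ 2 μ) => S ξ)
      (hR _ (hFB γ))).symm
  have hRL : ∀ γ ξ, R (leftTranslation γ ξ) = leftTranslation γ (R ξ) := fun γ ξ =>
    (congrArg (fun S : EllTwo Γ (Lp ℂ 2 μ) →L[ℂ] EllTwo Γ (Lp ℂ 2 μ) => S ξ)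
      (hR _ (hB γ))).symm
  have h1 := hasSum_apply_pointVector R (T (pointVector r v)) t
  have h2 := hasSum_apply_pointVector T (R (pointVector r v)) t
  let e : Γ ≃ Γ := ((Equiv.inv Γ).trans (Equiv.mulRight t)).trans (Equiv.mulLeft r)
  refine h1.unique ((e.hasSum_iff.2 h2).congr_fun fun u => ?_)
  have he : e u = r * (u⁻¹ * t) := rfl
  have hu : R (pointVector u v) t = R (pointVector r v) (e u) := by
    have : pointVector u v = leftTranslation (u * r⁻¹) (pointVector r v) := by
      rw [leftTranslation_pointVector, inv_mul_cancel_right]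
    rw [this, hRL, leftTranslation_apply, he]
    group
  rw [apply_pointVector_of_diagonalPart_eq hF, ← vnCoeffOp_pointVector, hRσ, vnCoeffOp_apply, hu,
    Function.comp_apply, apply_pointVector_of_diagonalPart_eq hF]
  congr 4
  rw [he]
  group

end Reconstruction

/-! ### The coefficients of an intermediate algebra -/

section BoundedConvergence

variable {X : Type*} [MeasurableSpace X] {μ : Measure X}

/-- Bounded almost everywhere convergence implies convergence in `L²` of a probability space. -/
theorem tendsto_lp_of_bounded_of_ae_tendsto [IsProbabilityMeasure μ] {v : ℕ → Lp ℂ 2 μ}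
    {w : Lp ℂ 2 μ} {C : ℝ} (hC : ∀ n, ∀ᵐ x ∂μ, ‖v n x‖ ≤ C)
    (h : ∀ᵐ x ∂μ, Tendsto (fun n => v n x) atTop (𝓝 (w x))) : Tendsto v atTop (𝓝 w) := by
  rw [tendsto_iff_norm_sub_tendsto_zero]
  have hall : ∀ᵐ x ∂μ, ∀ n, ‖v n x‖ ≤ C := ae_all_iff.2 hC
  have hlim : Tendsto (fun n => ∫⁻ x, ‖v n x - w x‖ₑ ^ 2 ∂μ) atTop (𝓝 (∫⁻ _, 0 ∂μ)) := by
    refine tendsto_lintegral_of_dominated_convergence' (fun _ => ENNReal.ofReal (2 * C) ^ 2)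
      (fun n => ((Lp.aestronglyMeasurable _).sub (Lp.aestronglyMeasurable _)).enorm.pow_const 2)
      (fun n => ?_) (by simp [ENNReal.mul_eq_top]) ?_
    · filter_upwards [hall, h] with x hx hlx
      have hw : ‖w x‖ ≤ C := le_of_tendsto hlx.norm (Eventually.of_forall hx)
      refine pow_le_pow_left' ?_ 2
      rw [← ofReal_norm]
      refine ENNReal.ofReal_le_ofReal ((norm_sub_le _ _).trans ?_)
      linarith [hx n]
    · filter_upwards [h] with x hlx
      have h1 : Tendsto (fun n => ‖v n x - w x‖ₑ) atTop (𝓝 0) := by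
        have := (hlx.sub_const (w x)).enorm
        simpa using this
      simpa using ENNReal.Tendsto.pow (n := 2) h1
  have e : ∀ n, ∫⁻ x, ‖v n x - w x‖ₑ ^ 2 ∂μ = ‖v n - w‖ₑ ^ 2 := fun n => by
    rw [enorm_sq_eq_lintegral]
    refine lintegral_congr_ae ?_
    filter_upwards [Lp.coeFn_sub (v n) w] with x hx
    rw [hx, Pi.sub_apply]
  simp only [e, lintegral_zero] at hlim
  have h2 := (ENNReal.tendsto_toReal ENNReal.zero_ne_top).comp hlim
  have h3 := h2.sqrt
  simpa [Function.comp_def, ENNReal.toReal_pow, Real.sqrt_sq] using h3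

end BoundedConvergence

section Coefficients

variable {Γ : Type*} [Group Γ] {X : Type*} [MeasurableSpace X] [MulAction Γ X]
  [MeasurableConstSMul Γ X] {μ : Measure X} [SMulInvariantMeasure Γ X μ]

/-- The function `u` is essentially bounded and `σ(u)` belongs to `A`. -/
def IsCoeff (A : VonNeumannAlgebra (EllTwo Γ (Lp ℂ 2 μ))) (u : X → ℂ) : Prop :=
  ∃ h : MemLp u ∞ μ, vnCoeffOp Γ μ (h.toLp u) ∈ A

variable {A : VonNeumannAlgebra (EllTwo Γ (Lp ℂ 2 μ))} {u v : X → ℂ}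

theorem coeFn_vnCoeffOp_toLp (hu : MemLp u ∞ μ) (ξ : EllTwo Γ (Lp ℂ 2 μ)) (t : Γ) :
    vnCoeffOp Γ μ (hu.toLp u) ξ t =ᵐ[μ] fun x => u (t • x) * ξ t x := by
  rw [vnCoeffOp_apply]
  filter_upwards [coeFn_mulOp (lpTranslate μ t (hu.toLp u)) (ξ t),
    coeFn_lpTranslate t (hu.toLp u), ae_smul t hu.coeFn_toLp] with x h1 h2 h3
  rw [h1, h2, h3]

theorem isCoeff_coeFn {f : Lp ℂ ∞ μ} : IsCoeff A f ↔ vnCoeffOp Γ μ f ∈ A := by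
  constructor
  · rintro ⟨h, hA⟩
    rwa [Lp.toLp_coeFn] at hA
  · intro h
    exact ⟨Lp.memLp f, by rwa [Lp.toLp_coeFn]⟩

theorem IsCoeff.congr (hu : IsCoeff A u) (h : u =ᵐ[μ] v) : IsCoeff A v := by
  obtain ⟨hm, hA⟩ := hu
  refine ⟨(memLp_congr_ae h).1 hm, ?_⟩
  rwa [← MemLp.toLp_congr hm ((memLp_congr_ae h).1 hm) h]

theorem IsCoeff.add (hu : IsCoeff A u) (hv : IsCoeff A v) : IsCoeff A (u + v) := by
  obtain ⟨hm, hA⟩ := hu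
  obtain ⟨hm', hA'⟩ := hv
  refine ⟨hm.add hm', ?_⟩
  rw [MemLp.toLp_add hm hm', vnCoeffOp_add]
  exact add_mem hA hA'

theorem IsCoeff.mul (hu : IsCoeff A u) (hv : IsCoeff A v) : IsCoeff A (u * v) := by
  obtain ⟨hm, hA⟩ := hu
  obtain ⟨hm', hA'⟩ := hv
  have hm2 : MemLp (u * v) ∞ μ := hm'.mul hm
  refine ⟨hm2, ?_⟩
  have e : vnCoeffOp Γ μ (hm2.toLp (u * v)) =
      vnCoeffOp Γ μ (hm.toLp u) * vnCoeffOp Γ μ (hm'.toLp v) := by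
    refine ContinuousLinearMap.ext fun ξ => lp.ext (funext fun t => Lp.ext ?_)
    filter_upwards [coeFn_vnCoeffOp_toLp hm2 ξ t, coeFn_vnCoeffOp_toLp hm' ξ t,
      coeFn_vnCoeffOp_toLp hm (vnCoeffOp Γ μ (hm'.toLp v) ξ) t] with x h1 h2 h3
    rw [h1]
    refine Eq.trans ?_ h3.symm
    rw [h2, Pi.mul_apply, mul_assoc]
  rw [e]
  exact mul_mem hA hA'

theorem IsCoeff.star (hu : IsCoeff A u) : IsCoeff A (star u) := by
  obtain ⟨hm, hA⟩ := hu
  have h := star_mem hA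
  rw [star_vnCoeffOp, ← isCoeff_coeFn] at h
  refine h.congr ?_
  filter_upwards [Lp.coeFn_star (hm.toLp u), hm.coeFn_toLp] with x h1 h2
  rw [h1, Pi.star_apply, Pi.star_apply, h2]

theorem IsCoeff.comp_smul (hA : ∀ s : Γ, leftTranslation s ∈ A) (hu : IsCoeff A u) (t : Γ) :
    IsCoeff A fun x => u (t • x) := by
  obtain ⟨hm, hm'⟩ := hu
  have h : vnCoeffOp Γ μ (lpTranslate μ t (hm.toLp u)) ∈ A := by
    have e := leftTranslation_mul_vnCoeffOp t⁻¹ (hm.toLp u)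
    rw [inv_inv] at e
    have e2 : vnCoeffOp Γ μ (lpTranslate μ t (hm.toLp u)) =
        leftTranslation t⁻¹ * vnCoeffOp Γ μ (hm.toLp u) * leftTranslation t := by
      rw [e, mul_assoc, ← leftTranslation_mul, inv_mul_cancel, leftTranslation_one, mul_one]
    rw [e2]
    exact mul_mem (mul_mem (hA _) hm') (hA _)
  refine (isCoeff_coeFn.2 h).congr ?_
  filter_upwards [coeFn_lpTranslate t (hm.toLp u), ae_smul t hm.coeFn_toLp] with x h1 h2
  rw [h1, h2]

variable [IsProbabilityMeasure μ]

theorem isCoeff_const (c : ℂ) : IsCoeff A fun _ => c := by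
  have hm : MemLp (fun _ : X => c) ∞ μ := memLp_const c
  refine ⟨hm, ?_⟩
  have e : vnCoeffOp Γ μ (hm.toLp _) = c • 1 := by
    refine ContinuousLinearMap.ext fun ξ => lp.ext (funext fun t => Lp.ext ?_)
    filter_upwards [coeFn_vnCoeffOp_toLp hm ξ t, Lp.coeFn_smul c (ξ t)] with x h1 h2
    rw [h1]
    exact h2.symm
  rw [e]
  exact VonNeumannAlgebra.smul_mem c (one_mem A)

theorem IsCoeff.const_mul (hu : IsCoeff A u) (c : ℂ) : IsCoeff A fun x => c * u x :=
  (isCoeff_const c).mul hu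

/-- The coefficients of a von Neumann algebra are closed under bounded pointwise limits. -/
theorem isCoeff_of_tendsto {w : ℕ → X → ℂ} (hw : ∀ n, IsCoeff A (w n)) {C : ℝ}
    (hC : ∀ n, ∀ᵐ x ∂μ, ‖w n x‖ ≤ C)
    (h : ∀ᵐ x ∂μ, Tendsto (fun n => w n x) atTop (𝓝 (u x))) : IsCoeff A u := by
  choose hm hA using hw
  have hall : ∀ᵐ x ∂μ, ∀ n, ‖w n x‖ ≤ C := ae_all_iff.2 hC
  have hmu : MemLp u ∞ μ := by
    refine memLp_top_of_bound (aestronglyMeasurable_of_tendsto_ae atTop (fun n => (hm n).1) h) C ?_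
    filter_upwards [hall, h] with x hx hlx
    exact le_of_tendsto hlx.norm (Eventually.of_forall hx)
  have hC0 : 0 ≤ C := by
    obtain ⟨x, hx⟩ := (hC 0).exists
    exact (norm_nonneg _).trans hx
  refine ⟨hmu, VonNeumannAlgebra.mem_of_tendsto hA fun ξ => ?_⟩
  refine tendsto_apply_of_tendsto_canonicalVector (C := C)
    (fun n => vnCoeffOp_mem_crossedProduct _) (vnCoeffOp_mem_crossedProduct _)
    (fun n => (norm_vnCoeffOp_le _).trans ?_) ?_ ξ
  · rw [Lp.norm_toLp, eLpNorm_exponent_top]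
    exact ENNReal.toReal_le_of_le_ofReal hC0 (eLpNormEssSup_le_of_ae_bound (hC n))
  · simp only [vnCoeffOp_pointVector, lpTranslate_one]
    refine ((continuous_pointVector (1 : Γ)).tendsto _).comp ?_
    have hone : ∀ {f : X → ℂ} (hf : MemLp f ∞ μ), mulOp μ (hf.toLp f) (oneL2 μ) =ᵐ[μ] f :=
      fun hf => (coeFn_mulOp_oneL2 _).trans hf.coeFn_toLp
    refine tendsto_lp_of_bounded_of_ae_tendsto (C := C) (fun n => ?_) ?_
    · filter_upwards [hone (hm n), hC n] with x h1 h2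
      rwa [h1]
    · filter_upwards [ae_all_iff.2 fun n => hone (hm n), hone hmu, h] with x h1 h2 h3
      simpa only [h1, h2] using h3

theorem IsCoeff.eval_polynomial {a : X → ℝ} (ha : IsCoeff A fun x => (a x : ℂ))
    (p : Polynomial ℝ) : IsCoeff A fun x => ((p.eval (a x) : ℝ) : ℂ) := by
  induction p using Polynomial.induction_on with
  | C c => simpa using isCoeff_const (A := A) (c : ℂ)
  | add p q hp hq =>
    simp only [Polynomial.eval_add, Complex.ofReal_add]
    exact hp.add hq
  | monomial n c h =>
    have e : (fun x => ((Polynomial.eval (a x) (Polynomial.C c * Polynomial.X ^ (n + 1)) : ℝ) : ℂ)) =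
        (fun x => ((Polynomial.eval (a x) (Polynomial.C c * Polynomial.X ^ n) : ℝ) : ℂ)) *
          fun x => (a x : ℂ) := by
      funext x
      simp [pow_succ, mul_assoc]
    rw [e]
    exact h.mul ha

/-- The spectral projections of a real coefficient are coefficients: `1_{a > c}` is a bounded
pointwise limit of polynomials in `a`. -/
theorem IsCoeff.indicator_Ioi {a : X → ℝ} (ha : IsCoeff A fun x => (a x : ℂ)) (c : ℝ) :
    IsCoeff A ((a ⁻¹' Set.Ioi c).indicator 1) := by
  obtain ⟨M, hM⟩ : ∃ M : ℝ, ∀ᵐ x ∂μ, a x ∈ Set.Icc (-M) M := by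
    obtain ⟨hm, -⟩ := ha
    refine ⟨(eLpNormEssSup (fun x => (a x : ℂ)) μ).toReal, ?_⟩
    have hfin : eLpNormEssSup (fun x => (a x : ℂ)) μ ≠ ∞ := by
      simpa using hm.eLpNorm_ne_top
    filter_upwards [ae_le_eLpNormEssSup (f := fun x => (a x : ℂ)) (μ := μ)] with x hx
    have h1 := ENNReal.toReal_mono hfin hx
    rw [toReal_enorm, Complex.norm_real, Real.norm_eq_abs] at h1
    exact abs_le.1 h1
  let g : ℕ → ℝ → ℝ := fun n t => min 1 (max 0 (n * (t - c)))
  have hg01 : ∀ n t, 0 ≤ g n t ∧ g n t ≤ 1 := fun n t =>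
    ⟨le_min zero_le_one (le_max_left _ _), min_le_left _ _⟩
  have hgc : ∀ n, Continuous (g n) := fun n => by fun_prop
  have hglim : ∀ t, Tendsto (fun n => g n t) atTop (𝓝 ((Set.Ioi c).indicator 1 t)) := by
    intro t
    by_cases ht : c < t
    · obtain ⟨N, hN⟩ := exists_nat_ge (1 / (t - c))
      refine tendsto_const_nhds.congr' ?_
      filter_upwards [eventually_ge_atTop N] with n hn
      have h1 : (1 : ℝ) ≤ n * (t - c) := by
        rw [div_le_iff₀ (sub_pos.2 ht)] at hN
        exact hN.trans (mul_le_mul_of_nonneg_right (by exact_mod_cast hn) (sub_pos.2 ht).le)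
      rw [Set.indicator_of_mem (by exact ht), Pi.one_apply]
      exact (min_eq_left (h1.trans (le_max_right _ _))).symm
    · rw [Set.indicator_of_notMem (by simpa using ht)]
      refine tendsto_const_nhds.congr fun n => ?_
      have h1 : (n : ℝ) * (t - c) ≤ 0 :=
        mul_nonpos_of_nonneg_of_nonpos n.cast_nonneg (by linarith)
      simp [g, max_eq_left h1]
  -- on the essential range of `a`, polynomials `p n` within `1 / (n + 1)` of the ramps `g n`
  choose p hp using fun n : ℕ => exists_polynomial_near_of_continuousOn (-M) M (g n)
    (hgc n).continuousOn (1 / ((n : ℝ) + 1)) Nat.one_div_pos_of_nat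
  refine isCoeff_of_tendsto (C := 2) (fun n => ha.eval_polynomial (p n)) (fun n => ?_) ?_
  · filter_upwards [hM] with x hx
    rw [Complex.norm_real, Real.norm_eq_abs]
    have h1 := abs_lt.1 (hp n (a x) hx)
    have h2 : 1 / ((n : ℝ) + 1) ≤ 1 := by
      rw [div_le_one (by positivity)]
      linarith [n.cast_nonneg (α := ℝ)]
    have h3 := hg01 n (a x)
    exact abs_le.2 ⟨by linarith, by linarith⟩
  · filter_upwards [hM] with x hx
    have h1 : Tendsto (fun n => (p n).eval (a x) - g n (a x)) atTop (𝓝 0) :=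
      squeeze_zero_norm (fun n => (hp n (a x) hx).le) tendsto_one_div_add_atTop_nhds_zero_nat
    have h2 := h1.add (hglim (a x))
    simp only [sub_add_cancel, zero_add] at h2
    have h3 := (Complex.continuous_ofReal.tendsto _).comp h2
    have e : (((Set.Ioi c).indicator 1 (a x) : ℝ) : ℂ) = (a ⁻¹' Set.Ioi c).indicator 1 x := by
      by_cases hx : c < a x <;> simp [hx]
    rwa [e] at h3

variable (A) in
/-- The `σ`-algebra of the measurable sets whose indicator functions are coefficients of `A`. -/
@[reducible] def coeffMeasurableSpace : MeasurableSpace X where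
  MeasurableSet' s := MeasurableSet s ∧ IsCoeff A (s.indicator 1)
  measurableSet_empty := ⟨MeasurableSet.empty, by
    rw [Set.indicator_empty]
    exact isCoeff_const 0⟩
  measurableSet_compl s hs := ⟨hs.1.compl, by
    have h := (isCoeff_const (A := A) 1).add (hs.2.const_mul (-1))
    refine h.congr (Eventually.of_forall fun x => ?_)
    by_cases hx : x ∈ s <;> simp [hx]⟩
  measurableSet_iUnion s hs := ⟨MeasurableSet.iUnion fun n => (hs n).1, by
    classical
    have hfin : ∀ n, IsCoeff A ((⋃ k, ⋃ (_ : k < n), s k).indicator 1) := by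
      intro n
      induction n with
      | zero =>
        simp only [Nat.not_lt_zero, Set.iUnion_of_empty, Set.iUnion_empty, Set.indicator_empty]
        exact isCoeff_const 0
      | succ n ih =>
        rw [Set.biUnion_lt_succ]
        have h := (ih.add (hs n).2).add ((ih.mul (hs n).2).const_mul (-1))
        refine h.congr (Eventually.of_forall fun x => ?_)
        by_cases h1 : x ∈ ⋃ k, ⋃ (_ : k < n), s k <;> by_cases h2 : x ∈ s n <;>
          simp only [Pi.add_apply, Pi.mul_apply, Set.indicator_apply, Set.mem_union, h1, h2,
            if_true, if_false, or_true, true_or, or_self, Pi.one_apply] <;> norm_num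
    refine isCoeff_of_tendsto (C := 1) hfin (fun n => Eventually.of_forall fun x => ?_)
      (Eventually.of_forall fun x => ?_)
    · rw [Set.indicator_apply]
      split_ifs <;> simp
    · by_cases hx : ∃ k, x ∈ s k
      · obtain ⟨k, hk⟩ := hx
        refine tendsto_const_nhds.congr' ?_
        filter_upwards [eventually_gt_atTop k] with n hn
        rw [Set.indicator_of_mem (Set.mem_iUnion.2 ⟨k, hk⟩),
          Set.indicator_of_mem (Set.mem_iUnion₂.2 ⟨k, hn, hk⟩)]
      · rw [Set.indicator_of_notMem (by simpa using hx)]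
        refine tendsto_const_nhds.congr fun n => ?_
        rw [Set.indicator_of_notMem]
        intro h
        obtain ⟨k, -, hk⟩ := Set.mem_iUnion₂.1 h
        exact hx ⟨k, hk⟩⟩

theorem measurable_coeffMeasurableSpace {a : X → ℝ} (hm : Measurable a)
    (ha : IsCoeff A fun x => (a x : ℂ)) : Measurable[coeffMeasurableSpace A] a :=
  @measurable_of_Ioi _ _ _ _ _ (coeffMeasurableSpace A) _ _ _ _ fun c =>
    ⟨hm measurableSet_Ioi, ha.indicator_Ioi c⟩

/-- Bounded functions that factor through a map measurable for `coeffMeasurableSpace A` are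
coefficients of `A`. -/
theorem isCoeff_comp {Y : Type*} [MeasurableSpace Y] {η : Measure Y} {φ : X → Y}
    (hφ : MeasurePreserving φ μ η) (hφA : Measurable[coeffMeasurableSpace A] φ) (g : Lp ℂ ∞ η) :
    IsCoeff A (g ∘ φ) := by
  classical
  have hsimple : ∀ f : SimpleFunc Y ℂ, IsCoeff A (f ∘ φ) := by
    intro f
    induction f using SimpleFunc.induction with
    | const c hs =>
      refine ((hφA hs).2.const_mul c).congr (Eventually.of_forall fun x => ?_)
      simp only [Set.indicator_apply, Function.comp_apply, SimpleFunc.coe_piecewise,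
        SimpleFunc.coe_const, Set.piecewise, Set.mem_preimage, Pi.one_apply, Function.const_apply]
      split_ifs <;> simp
    | add _ h1 h2 => exact h1.add h2
  obtain ⟨C, hC0, hC⟩ : ∃ C : ℝ, 0 ≤ C ∧ ∀ᵐ y ∂η, ‖g y‖ ≤ C := by
    refine ⟨(eLpNormEssSup g η).toReal, ENNReal.toReal_nonneg, ?_⟩
    have hfin : eLpNormEssSup g η ≠ ∞ := by
      simpa using (Lp.memLp g).eLpNorm_ne_top
    filter_upwards [ae_le_eLpNormEssSup (f := g) (μ := η)] with y hy
    simpa using ENNReal.toReal_mono hfin hy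
  have hg := Lp.stronglyMeasurable g
  exact isCoeff_of_tendsto (fun n => hsimple (hg.approxBounded C n))
    (fun n => Eventually.of_forall fun x => hg.norm_approxBounded_le hC0 n (φ x))
    (hφ.quasiMeasurePreserving.ae (hg.tendsto_approxBounded_ae hC))

end Coefficients

/-! ### The factor generated by the coefficients -/

section Factor

variable (Γ : Type*) [Group Γ] [Countable Γ]

/-- The space of all maps from `Γ` to real sequences, on which `Γ` acts by right translation of the
argument. The group is replaced by a copy in `Type`. -/
def ShiftSpace : Type := Shrink.{0} Γ → ℕ → ℝ

instance : MeasurableSpace (ShiftSpace Γ) :=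
  inferInstanceAs (MeasurableSpace (Shrink.{0} Γ → ℕ → ℝ))

instance : StandardBorelSpace (ShiftSpace Γ) :=
  have : Countable (Shrink.{0} Γ) := (equivShrink.{0} Γ).symm.injective.countable
  inferInstanceAs (StandardBorelSpace (Shrink.{0} Γ → ℕ → ℝ))

noncomputable instance : MulAction Γ (ShiftSpace Γ) where
  smul γ y := fun k => y (equivShrink.{0} Γ ((equivShrink.{0} Γ).symm k * γ))
  one_smul y := funext fun k => by
    change y (equivShrink.{0} Γ ((equivShrink.{0} Γ).symm k * 1)) = y k
    rw [mul_one, Equiv.apply_symm_apply]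
  mul_smul γ δ y := funext fun k => by
    change y (equivShrink.{0} Γ ((equivShrink.{0} Γ).symm k * (γ * δ))) =
      y (equivShrink.{0} Γ
        ((equivShrink.{0} Γ).symm (equivShrink.{0} Γ ((equivShrink.{0} Γ).symm k * γ)) * δ))
    rw [Equiv.symm_apply_apply, mul_assoc]

instance : MeasurableConstSMul Γ (ShiftSpace Γ) where
  measurable_const_smul γ := measurable_pi_lambda _ fun k =>
    measurable_pi_apply (equivShrink.{0} Γ ((equivShrink.{0} Γ).symm k * γ))

variable {Γ} {X : Type*} [MulAction Γ X]

variable (Γ) in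
/-- The map recording the values of the functions `d n` along the orbit of a point. -/
noncomputable def orbitMap (d : ℕ → X → ℝ) (x : X) : ShiftSpace Γ :=
  fun k n => d n ((equivShrink.{0} Γ).symm k • x)

theorem orbitMap_smul (d : ℕ → X → ℝ) (γ : Γ) (x : X) :
    orbitMap Γ d (γ • x) = γ • orbitMap Γ d x := by
  funext k n
  change d n ((equivShrink.{0} Γ).symm k • γ • x) =
    d n ((equivShrink.{0} Γ).symm (equivShrink.{0} Γ ((equivShrink.{0} Γ).symm k * γ)) • x)
  rw [Equiv.symm_apply_apply, mul_smul]

theorem measurable_comap_orbitMap (d : ℕ → X → ℝ) (n : ℕ) :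
    Measurable[MeasurableSpace.comap (orbitMap Γ d) inferInstance] (d n) := by
  have h : d n = (fun y : ShiftSpace Γ => y (equivShrink.{0} Γ 1) n) ∘ orbitMap Γ d := by
    funext x
    simp [orbitMap]
  have hm : Measurable fun y : ShiftSpace Γ => y (equivShrink.{0} Γ 1) n :=
    (measurable_pi_apply n).comp (measurable_pi_apply (equivShrink.{0} Γ 1))
  rw [h]
  exact hm.comp (comap_measurable (orbitMap Γ d))

variable [MeasurableSpace X]

theorem measurable_orbitMap [MeasurableConstSMul Γ X] {d : ℕ → X → ℝ}
    (hd : ∀ n, Measurable (d n)) : Measurable (orbitMap Γ d) :=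
  measurable_pi_lambda _ fun k => measurable_pi_lambda _ fun n =>
    (hd n).comp (measurable_const_smul ((equivShrink.{0} Γ).symm k))

variable [MeasurableConstSMul Γ X] (μ : Measure X) [SMulInvariantMeasure Γ X μ]

/-- The factor of `(X, μ)` generated by a sequence of measurable functions and their
translates. -/
noncomputable def orbitFactor {d : ℕ → X → ℝ} (hd : ∀ n, Measurable (d n)) :
    MeasurableFactor Γ μ where
  Y := ShiftSpace Γ
  η := μ.map (orbitMap Γ d)
  invariant := ⟨fun γ s hs => by
    rw [Measure.map_apply (measurable_orbitMap hd) (measurable_const_smul γ hs),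
      Measure.map_apply (measurable_orbitMap hd) hs,
      ← (measurePreserving_smul γ μ).measure_preimage (measurable_orbitMap hd hs).nullMeasurableSet]
    congr 1
    ext x
    simp only [Set.mem_preimage, orbitMap_smul]⟩
  toFun := orbitMap Γ d
  measurePreserving := (measurable_orbitMap hd).measurePreserving μ
  equivariant γ := Eventually.of_forall (orbitMap_smul d γ)

variable {μ} [IsProbabilityMeasure μ]

/-- There is a sequence of real coefficients of `A` that is dense, in `L²`, among all real
coefficients. -/
theorem exists_seq_isCoeff [StandardBorelSpace X]
    (A : VonNeumannAlgebra (EllTwo Γ (Lp ℂ 2 μ))) :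
    ∃ d : ℕ → X → ℝ, (∀ n, Measurable (d n)) ∧ (∀ n, IsCoeff A fun x => (d n x : ℂ)) ∧
      ∀ a : X → ℝ, IsCoeff A (fun x => (a x : ℂ)) →
        AEStronglyMeasurable[MeasurableSpace.comap (orbitMap Γ d) inferInstance] a μ := by
  have : Fact ((2 : ℝ≥0∞) ≠ ∞) := ⟨by simp⟩
  let S : Set (Lp ℝ 2 μ) := {v | IsCoeff A fun x => (v x : ℂ)}
  have h0 : (0 : Lp ℝ 2 μ) ∈ S :=
    (isCoeff_const (A := A) 0).congr (Eventually.of_forall fun x => by simp)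
  have : Nonempty S := ⟨⟨0, h0⟩⟩
  let d : ℕ → X → ℝ := fun n => (TopologicalSpace.denseSeq S n : Lp ℝ 2 μ)
  have hd : ∀ n, Measurable (d n) := fun n => (Lp.stronglyMeasurable _).measurable
  refine ⟨d, hd, fun n => (TopologicalSpace.denseSeq S n).2, fun a ha => ?_⟩
  have hm : MemLp a 2 μ := by
    obtain ⟨h, -⟩ := ha
    exact (h.mono_exponent le_top).re
  have hS : hm.toLp a ∈ S := ha.congr (by
    filter_upwards [hm.coeFn_toLp] with x hx
    rw [hx])
  have hcl := isClosed_aestronglyMeasurable (F := ℝ) (p := 2) (μ := μ)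
    (measurable_orbitMap (Γ := Γ) hd).comap_le
  have hdense := (TopologicalSpace.denseRange_denseSeq S) ⟨hm.toLp a, hS⟩
  have hmem : AEStronglyMeasurable[MeasurableSpace.comap (orbitMap Γ d) inferInstance]
      (hm.toLp a) μ := by
    refine (hcl.preimage continuous_subtype_val).closure_subset_iff.2 ?_ hdense
    rintro _ ⟨n, rfl⟩
    exact (measurable_comap_orbitMap (Γ := Γ) d n).stronglyMeasurable.aestronglyMeasurable
  exact hmem.congr hm.coeFn_toLp

/-- There is a factor of the system such that the coefficients of `A` are exactly the bounded
functions that factor through it. -/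
theorem exists_factor_forall_isCoeff_iff [StandardBorelSpace X]
    {A : VonNeumannAlgebra (EllTwo Γ (Lp ℂ 2 μ))} (hA : ∀ s : Γ, leftTranslation s ∈ A) :
    ∃ F : MeasurableFactor Γ μ, ∀ f : Lp ℂ ∞ μ, vnCoeffOp Γ μ f ∈ A ↔
      ∃ g : Lp ℂ ∞ F.η, Lp.compMeasurePreserving F.toFun F.measurePreserving g = f := by
  obtain ⟨d, hd, hdA, hdense⟩ := exists_seq_isCoeff A
  refine ⟨orbitFactor μ hd, fun f => ⟨fun hf => ?_, ?_⟩⟩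
  · have hlift : ∀ a : X → ℝ, IsCoeff A (fun x => (a x : ℂ)) →
        ∃ b : ShiftSpace Γ → ℝ, Measurable b ∧ a =ᵐ[μ] b ∘ orbitMap Γ d := by
      intro a ha
      obtain ⟨a', ha', hae⟩ := hdense a ha
      obtain ⟨b, hb, rfl⟩ := ha'.measurable.exists_eq_measurable_comp
      exact ⟨b, hb, hae⟩
    -- the real and imaginary parts of `f` are coefficients and are lifted separately
    have hf' := isCoeff_coeFn.2 hf
    obtain ⟨b, hb, hab⟩ := hlift (fun x => (f x).re)
      (((hf'.add hf'.star).const_mul (1 / 2)).congr (Eventually.of_forall fun x => by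
        refine Complex.ext ?_ (by simp)
        simp
        ring))
    obtain ⟨c, hc, hac⟩ := hlift (fun x => (f x).im)
      (((hf'.add (hf'.star.const_mul (-1))).const_mul (-Complex.I / 2)).congr
        (Eventually.of_forall fun x => by
          refine Complex.ext ?_ (by simp)
          simp
          ring))
    let g : ShiftSpace Γ → ℂ := fun y => (b y : ℂ) + c y * Complex.I
    have hg : Measurable g := by fun_prop
    have hfg : f =ᵐ[μ] g ∘ orbitMap Γ d := by
      filter_upwards [hab, hac] with x h1 h2
      simp only [Function.comp_apply] at h1 h2
      simp only [g, Function.comp_apply, ← h1, ← h2, Complex.re_add_im]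
    have hmem : MemLp g ∞ (μ.map (orbitMap Γ d)) :=
      (memLp_map_measure_iff hg.aestronglyMeasurable (measurable_orbitMap hd).aemeasurable).2
        ((memLp_congr_ae hfg).1 (Lp.memLp f))
    refine ⟨hmem.toLp g, Lp.ext ?_⟩
    have h1 := Lp.coeFn_compMeasurePreserving (hmem.toLp g)
      ((measurable_orbitMap (Γ := Γ) hd).measurePreserving μ)
    have h2 := ((measurable_orbitMap (Γ := Γ) hd).measurePreserving μ).quasiMeasurePreserving.ae
      hmem.coeFn_toLp
    filter_upwards [h1, h2, hfg] with x h1 h2 h3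
    refine h1.trans ?_
    rw [Function.comp_apply, h2, h3, Function.comp_apply]
  · rintro ⟨g, rfl⟩
    have hφA : Measurable[coeffMeasurableSpace A] (orbitMap Γ d) := by
      refine @measurable_pi_lambda _ _ _ (coeffMeasurableSpace A) _ _ fun k =>
        @measurable_pi_lambda _ _ _ (coeffMeasurableSpace A) _ _ fun n => ?_
      exact measurable_coeffMeasurableSpace
        ((hd n).comp (measurable_const_smul ((equivShrink.{0} Γ).symm k)))
        ((hdA n).comp_smul hA ((equivShrink.{0} Γ).symm k))
    rw [← isCoeff_coeFn]
    exact (isCoeff_comp (orbitFactor μ hd).measurePreserving hφA g).congr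
      (Lp.coeFn_compMeasurePreserving g (orbitFactor μ hd).measurePreserving).symm

/-- An intermediate von Neumann algebra that is invariant under the conditional expectation is the
crossed product of a factor. -/
theorem exists_factor_eq_crossedProduct [StandardBorelSpace X]
    {A : VonNeumannAlgebra (EllTwo Γ (Lp ℂ 2 μ))} (hA : ∀ s : Γ, leftTranslation s ∈ A)
    (hAM : A ≤ vonNeumannCrossedProduct Γ μ) (hE : ∀ T ∈ A, diagonalPart T ∈ A) :
    ∃ F : MeasurableFactor Γ μ, A = F.crossedProduct := by
  obtain ⟨F, hF⟩ := exists_factor_forall_isCoeff_iff hA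
  refine ⟨F, le_antisymm (fun T hT => ?_) (vonNeumannGenerated_le ?_)⟩
  · have hTγ : ∀ γ : Γ, T * leftTranslation γ⁻¹ ∈ A := fun γ => mul_mem hT (hA γ⁻¹)
    choose f hf using fun γ : Γ => exists_diagonalPart_eq_vnCoeffOp (hAM (hTγ γ))
    refine mem_of_forall_coeff_mem (fun s => subset_vonNeumannGenerated _ (Or.inr ⟨s, rfl⟩)) hf
      fun γ => ?_
    have h := hE _ (hTγ γ)
    rw [hf γ] at h
    obtain ⟨g, hg⟩ := (hF (f γ)).1 h
    exact subset_vonNeumannGenerated _ (Or.inl ⟨g, by rw [← hg]⟩)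
  · rintro _ (⟨g, rfl⟩ | ⟨s, rfl⟩)
    · exact (hF _).2 ⟨g, rfl⟩
    · exact hA s

end Factor

theorem theorem1p5 {Γ : Type*} [Group Γ] [Countable Γ]
    {Z : Type*} [TopologicalSpace Z] [CompactSpace Z] [T2Space Z]
    [MeasurableSpace Z] [BorelSpace Z] [MulAction Γ Z] [ContinuousConstSMul Γ Z]
    (hZ : IsBoundary Γ Z) (hfree : IsTopologicallyFree Γ Z) :
    (∀ (X : Type*) [UniformSpace X] [CompactSpace X] [T2Space X]
        [MulAction Γ X] [ContinuousConstSMul Γ X],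
      IsUniformlyRigid Γ X →
      ∀ (ι : Type*) (l : Filter ι) [l.NeBot] (s : ι → Γ),
        IsRigidNet X l s → IsStronglyProximalNet Z l s →
        ∀ (H : Type*) [NormedAddCommGroup H] [InnerProductSpace ℂ H] [CompleteSpace H]
          (π : C(X, ℂ) →⋆ₐ[ℂ] (H →L[ℂ] H)), Function.Injective π →
          IsAlmostReflecting Γ π) ∧
    (∀ (X : Type*) [MeasurableSpace X] [StandardBorelSpace X]
        [MulAction Γ X] [MeasurableConstSMul Γ X]
        (μ : Measure X) [IsProbabilityMeasure μ] [SMulInvariantMeasure Γ X μ],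
      IsMeasureRigid Γ μ →
      ∀ (ι : Type*) (l : Filter ι) [l.NeBot] (s : ι → Γ),
        IsMeasureRigidNet μ l s → IsStronglyProximalNet Z l s →
        IsReflecting Γ μ) := by
  refine ⟨?_, ?_⟩
  · intro X _ _ _ _ _ _ ι l _ s hrig hprox H _ _ _ π _
    exact isAlmostReflecting_of_rigid_of_proximal hZ hfree hrig hprox π
  · intro X _ _ _ _ μ _ _ _ ι l _ s hrig hprox A hLA hAM
    have hA : ∀ s : Γ, leftTranslation s ∈ A := fun s =>
      hLA (subset_vonNeumannGenerated _ ⟨s, rfl⟩)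
    exact exists_factor_eq_crossedProduct hA hAM fun T hT =>
      diagonalPart_mem_of_rigid_of_proximal hZ hfree hrig hprox hA hAM hT
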